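/- Conventions. Algorithms are deterministic (multi-stack) Turing machines. A parameterized problem with parameter $k$ is solvable in time $\mathcal{O}^*(f(k))$ if there are an algorithm and constants $C, c \in \mathbb{N}$ such that the algorithm decides every instance $x$ within $C \cdot f(k) \cdot (|x|+1)^{c}$ steps, where $|x|$ is the length of the encoding of $x$. 3-SAT asks whether a Boolean formula in conjunctive normal form with clauses of size at most $3$ is satisfiable. The Exponential-Time Hypothesis (ETH) states that there is an $\varepsilon > 0$ such that 3-SAT on $n$ variables cannot be solved in time $\mathcal{O}^*(2^{\varepsilon n})$. For a positive integer $q$, consider the following parameterized problem, $q$-Coloring parameterized by vertex cover: the input is a finite simple graph $G$ together with a vertex cover $X \subseteq V(G)$ of $G$ (that is, $G - X$ has no edges); the parameter is $k = |X|$; the question is whether $G$ has a proper coloring with $q$ colors. Theorem. Unless ETH fails, there is no constant $\theta \in \mathbb{R}$ such that, for every fixed integer $q \ge 1$, $q$-Coloring parameterized by vertex cover can be solved in time $\mathcal{O}^*(\theta^k)$. (Here the algorithm and the constants hidden in $\mathcal{O}^*$ may depend on $q$, while $\theta$ may not.) -/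

import Mathlib

/-! ### Parameterized problems and the running time of algorithms -/

/-- A parameterized (promise) decision problem: its instances, an injective encoding of the instances
as words over an alphabet, the parameter of an instance, and the set of yes-instances. -/
structure ParamProblem where
  Inst : Type
  Symbol : Type
  encode : Inst → List Symbol
  encode_injective : Function.Injective encode
  param : Inst → ℕ
  IsYes : Inst → Prop

/-- `Q.SolvableInOStar f`: the problem `Q` is decided in time `O*(f(k))`, where `k` is the parameter.
There are one (deterministic, finite, multi-stack) Turing machine and constants `C`, `c` such that
on every instance `x`, given as the word `Q.encode x`, the machine halts after at most
`C * f(k) * (|x| + 1) ^ c` steps with the single output symbol `true` if `x` is a yes-instance,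
and `false` otherwise; here `|x|` is the length of the input word. -/
def ParamProblem.SolvableInOStar (Q : ParamProblem) (f : ℕ → ℝ) : Prop :=
  ∃ (M : Turing.TM2ComputableAux Q.Symbol Bool) (C c : ℕ), ∀ x : Q.Inst, ∃ t : ℕ,
    (t : ℝ) ≤ C * f (Q.param x) * (((Q.encode x).length : ℝ) + 1) ^ c ∧
    ∃ answer : Bool, (answer = true ↔ Q.IsYes x) ∧
      Nonempty (Turing.TM2OutputsInTime M.tm
        ((Q.encode x).map M.inputAlphabet.symm)
        (some ([answer].map M.outputAlphabet.symm)) t)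

/-! ### 3-SAT and the Exponential-Time Hypothesis -/

/-- A Boolean formula in conjunctive normal form with variables indexed by `Fin numVars` and clauses
of size at most three. A literal `(i, true)` is the variable `i`, and `(i, false)` its negation. -/
structure ThreeCNF where
  numVars : ℕ
  clauses : List (List (Fin numVars × Bool))
  length_le : ∀ C ∈ clauses, C.length ≤ 3

/-- The formula has a satisfying assignment. -/
def ThreeCNF.Satisfiable (φ : ThreeCNF) : Prop :=
  ∃ a : Fin φ.numVars → Bool, ∀ C ∈ φ.clauses, ∃ l ∈ C, a l.1 = l.2

/-- The input alphabet for formulas: a unary digit, the start of a clause, and the start of a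
positive (`lit true`) or negative (`lit false`) literal. -/
inductive CNFSymbol where
  | tick : CNFSymbol
  | clause : CNFSymbol
  | lit : Bool → CNFSymbol

/-- A literal is written as its sign, followed by the index of its variable in unary. -/
def encodeLiteral {n : ℕ} (l : Fin n × Bool) : List CNFSymbol :=
  CNFSymbol.lit l.2 :: List.replicate l.1.val CNFSymbol.tick

/-- A clause is written as a start symbol, followed by its literals. -/
def encodeClause {n : ℕ} (C : List (Fin n × Bool)) : List CNFSymbol :=
  CNFSymbol.clause :: C.flatMap encodeLiteral

/-- A formula is written as its number of variables in unary, followed by its clauses. -/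
def ThreeCNF.encode (φ : ThreeCNF) : List CNFSymbol :=
  List.replicate φ.numVars CNFSymbol.tick ++ φ.clauses.flatMap encodeClause

theorem replicate_tick_append_inj {a b : ℕ} {L M : List CNFSymbol}
    (hL : L.head? ≠ some CNFSymbol.tick) (hM : M.head? ≠ some CNFSymbol.tick)
    (h : List.replicate a CNFSymbol.tick ++ L = List.replicate b CNFSymbol.tick ++ M) :
    a = b ∧ L = M := by
  induction a generalizing b with
  | zero =>
    cases b with
    | zero => simpa using h
    | succ b => exact absurd (by simp_all [List.replicate_succ]) hL
  | succ a ih =>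
    cases b with
    | zero =>
      have h' : M = List.replicate (a + 1) CNFSymbol.tick ++ L := by simpa using h.symm
      exact absurd (by simp [h', List.replicate_succ]) hM
    | succ b =>
      simp only [List.replicate_succ, List.cons_append, List.cons.injEq, true_and] at h
      obtain ⟨h1, h2⟩ := ih h
      exact ⟨by omega, h2⟩

theorem head?_literals_append {n : ℕ} (C : List (Fin n × Bool)) {R : List CNFSymbol}
    (hR : R.head? ≠ some CNFSymbol.tick) :
    (C.flatMap encodeLiteral ++ R).head? ≠ some CNFSymbol.tick := by
  cases C <;> simp [encodeLiteral, hR]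

theorem literals_append_inj {n : ℕ} {C D : List (Fin n × Bool)} {R S : List CNFSymbol}
    (hR : R.head? = none ∨ R.head? = some CNFSymbol.clause)
    (hS : S.head? = none ∨ S.head? = some CNFSymbol.clause)
    (h : C.flatMap encodeLiteral ++ R = D.flatMap encodeLiteral ++ S) : C = D ∧ R = S := by
  induction C generalizing D with
  | nil =>
    cases D with
    | nil => simpa using h
    | cons d D =>
      have : R.head? = some (CNFSymbol.lit d.2) := by
        simp only [List.flatMap_nil, List.nil_append] at h
        simp [h, encodeLiteral]
      rcases hR with hR | hR <;> simp [hR] at this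
  | cons c C ih =>
    cases D with
    | nil =>
      have : S.head? = some (CNFSymbol.lit c.2) := by
        simp only [List.flatMap_nil, List.nil_append] at h
        simp [← h, encodeLiteral]
      rcases hS with hS | hS <;> simp [hS] at this
    | cons d D =>
      simp only [List.flatMap_cons, encodeLiteral, List.cons_append, List.append_assoc,
        List.cons.injEq, CNFSymbol.lit.injEq] at h
      obtain ⟨h1, h2⟩ := h
      obtain ⟨h3, h4⟩ := replicate_tick_append_inj
        (head?_literals_append C (by rcases hR with h | h <;> simp [h]))
        (head?_literals_append D (by rcases hS with h | h <;> simp [h])) h2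
      obtain ⟨h5, h6⟩ := ih h4
      exact ⟨by rw [h5, Prod.ext (Fin.ext h3) h1], h6⟩

theorem head?_clauses {n : ℕ} (F : List (List (Fin n × Bool))) :
    (F.flatMap encodeClause).head? = none ∨
      (F.flatMap encodeClause).head? = some CNFSymbol.clause := by
  cases F <;> simp [encodeClause]

theorem clauses_inj {n : ℕ} {F H : List (List (Fin n × Bool))}
    (h : F.flatMap encodeClause = H.flatMap encodeClause) : F = H := by
  induction F generalizing H with
  | nil => cases H <;> simp_all [encodeClause]
  | cons C F ih =>
    cases H with
    | nil => simp [encodeClause] at h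
    | cons D H =>
      simp only [List.flatMap_cons, encodeClause, List.cons_append, List.cons.injEq,
        true_and] at h
      obtain ⟨h1, h2⟩ := literals_append_inj (head?_clauses F) (head?_clauses H) h
      rw [h1, ih h2]

theorem ThreeCNF.encode_injective : Function.Injective ThreeCNF.encode := by
  rintro ⟨n, F, hF⟩ ⟨m, H, hH⟩ h
  obtain ⟨h1, h2⟩ := replicate_tick_append_inj
    (by rcases head?_clauses F with h | h <;> simp [h])
    (by rcases head?_clauses H with h | h <;> simp [h]) h
  obtain rfl : n = m := h1
  obtain rfl : F = H := clauses_inj h2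
  rfl

/-- 3-SAT, parameterized by the number of variables. -/
def ThreeSAT : ParamProblem where
  Inst := ThreeCNF
  Symbol := CNFSymbol
  encode := ThreeCNF.encode
  encode_injective := ThreeCNF.encode_injective
  param φ := φ.numVars
  IsYes φ := φ.Satisfiable

/-- The Exponential-Time Hypothesis: there is an `ε > 0` such that 3-SAT on `n` variables cannot be
solved in time `O*(2 ^ (ε n))`. -/
def ETH : Prop :=
  ∃ ε : ℝ, 0 < ε ∧ ¬ ThreeSAT.SolvableInOStar (fun n => (2 : ℝ) ^ (ε * (n : ℝ)))

/-! ### Coloring graphs with a given vertex cover -/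

/-- A finite simple graph together with a vertex cover of it, that is, a set of vertices whose
removal leaves an independent graph. -/
structure CoveredGraph where
  numVertices : ℕ
  graph : SimpleGraph (Fin numVertices)
  cover : Finset (Fin numVertices)
  isVertexCover : graph.IsVertexCover (cover : Set (Fin numVertices))

/-- The input alphabet for graphs: the start of a row of the adjacency matrix, marked with whether
the vertex of this row belongs to the vertex cover, and an entry of the adjacency matrix. -/
inductive GraphSymbol where
  | row : Bool → GraphSymbol
  | entry : Bool → GraphSymbol

open Classical in
/-- A graph with a vertex cover is written as its adjacency matrix, row by row; each row begins with
a symbol that tells whether its vertex belongs to the vertex cover. -/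
noncomputable def CoveredGraph.encode (I : CoveredGraph) : List GraphSymbol :=
  (List.finRange I.numVertices).flatMap fun u =>
    GraphSymbol.row (decide (u ∈ I.cover)) ::
      (List.finRange I.numVertices).map fun v => GraphSymbol.entry (decide (I.graph.Adj u v))

theorem flatMap_inj_of_length {α β : Type} {f g : α → List β} {l : List α}
    (hlen : ∀ a, (f a).length = (g a).length) (h : l.flatMap f = l.flatMap g) :
    ∀ a ∈ l, f a = g a := by
  induction l with
  | nil => simp
  | cons b l ih =>
    simp only [List.flatMap_cons] at h
    obtain ⟨h1, h2⟩ := List.append_inj h (hlen b)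
    intro a ha
    rcases List.mem_cons.1 ha with rfl | ha
    · exact h1
    · exact ih h2 a ha

theorem CoveredGraph.length_encode (I : CoveredGraph) :
    I.encode.length = I.numVertices * (I.numVertices + 1) := by
  simp [CoveredGraph.encode, List.length_flatMap]

theorem CoveredGraph.encode_injective : Function.Injective CoveredGraph.encode := by
  rintro ⟨n, G, X, hX⟩ ⟨m, H, Y, hY⟩ h
  have hlen := congrArg List.length h
  simp only [CoveredGraph.length_encode] at hlen
  obtain rfl : n = m := by
    rcases lt_trichotomy n m with hlt | heq | hlt
    · nlinarith
    · exact heq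
    · nlinarith
  have key := flatMap_inj_of_length (by simp) h
  obtain rfl : X = Y := by
    ext u
    have := key u (List.mem_finRange u)
    simp only [List.cons.injEq, GraphSymbol.row.injEq, decide_eq_decide] at this
    exact this.1
  obtain rfl : G = H := by
    ext u v
    have := key u (List.mem_finRange u)
    simp only [List.cons.injEq, List.map_inj_left, GraphSymbol.entry.injEq,
      decide_eq_decide] at this
    exact this.2 v (List.mem_finRange v)
  rfl

/-- `q`-Coloring on graphs with a given vertex cover, parameterized by the size of the given vertex
cover. -/
noncomputable def ColoringByVertexCover (q : ℕ) : ParamProblem where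
  Inst := CoveredGraph
  Symbol := GraphSymbol
  encode := CoveredGraph.encode
  encode_injective := CoveredGraph.encode_injective
  param I := I.cover.card
  IsYes I := I.graph.Colorable q

/-! Suppose one `θ` served every number of colors. Given `ε > 0`, fix a large block length `s`, cut
the `n` variables of a 3-CNF formula into `⌈n/s⌉` blocks, and let a single color encode an
assignment to a whole block. With `q = 3 * 2 ^ s` colors the formula becomes a graph with a vertex
cover of size at most `3 * 2 ^ s + 3⌈n/s⌉`. Up to factors that are constant for fixed `s` or
polynomial, coloring it costs `θ ^ (3n/s)`, which is at most `2 ^ (ε n)` for large `s`. Since `ε` is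
arbitrary, ETH fails.

A color is a pair `(j, A)` with `j < 3` and `A` an assignment to `s` variables. A palette clique of
`q` vertices names the colors. Each block has three vertices; the `j`-th is joined to all palette
vertices whose first coordinate is not `j`, so its color is some `(j, A)`. A block or clause that
forbids a triple `a` of assignments has a pattern vertex for it, joined to the palette except for
the colors `(j, a j)` of the slots `j` in use, and to the `j`-th vertex of the block in slot `j`. It
can be colored exactly if some used slot does not show `a j`. The first coordinate keeps the slots
apart: the block vertex of one slot cannot take the color reserved for another. A block forbids
non-constant triples, so its three copies agree; a clause forbids the triples that falsify all its
literals. Pattern vertices are independent, so clauses cost nothing in the cover. `exists_coloring`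
and `satisfiable_of_coloring` are the two directions, `card_cover_le` bounds the parameter, and
`exists_pow_numBlocks_le` chooses `s`.

What remains is polynomial time on Turing machines. Programs of a small stack language are compiled
in front of a given machine (`Runs.outputsInTime_prepend`). One program turns the formula into a
list of items (palette, blocks, clauses) with block indices in unary (`runs_itemsProg`); another
compares all pairs of items and writes the adjacency matrix (`runs_matrixProg`). Outputs grow at the
head, which is why lists appear reversed throughout. -/

/-! ### A structured programming language for stack machines -/

/-- Structured programs that work on stacks `K` with alphabets `Γ` and a finite state `σ`, and that
write letters of `β` to an output that is never read. -/
inductive Prog (K : Type) (Γ : K → Type) (β σ : Type) : Type where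
  | push : (k : K) → (σ → Γ k) → Prog K Γ β σ
  | pop : (k : K) → (σ → Option (Γ k) → σ) → Prog K Γ β σ
  | load : (σ → σ) → Prog K Γ β σ
  | emit : (σ → β) → Prog K Γ β σ
  | seq : Prog K Γ β σ → Prog K Γ β σ → Prog K Γ β σ
  | switch : (σ → Prog K Γ β σ) → Prog K Γ β σ
  | loop : (σ → Bool) → Prog K Γ β σ → Prog K Γ β σ

/-- A memory state of a program: the finite state, the stacks, and the output with the letter
written last as its head. -/
structure Mem (K : Type) (Γ : K → Type) (β σ : Type) where
  var : σ
  stk : ∀ k, List (Γ k)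
  out : List β

namespace Prog

variable {K : Type} {Γ : K → Type} {β σ : Type}

/-- The control points of a program. -/
def Label : Prog K Γ β σ → Type
  | push _ _ => Unit
  | pop _ _ => Unit
  | load _ => Unit
  | emit _ => Unit
  | seq p q => p.Label ⊕ q.Label
  | switch p => Option (Σ v, (p v).Label)
  | loop _ p => Option p.Label

/-- The control point at which a program starts. -/
def entry : (p : Prog K Γ β σ) → p.Label
  | push _ _ => ()
  | pop _ _ => ()
  | load _ => ()
  | emit _ => ()
  | seq p _ => Sum.inl p.entry
  | switch _ => none
  | loop _ _ => none

theorem finite_label [Finite σ] (p : Prog K Γ β σ) : Finite p.Label := by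
  induction p with
  | push | pop | load | emit => exact inferInstanceAs (Finite Unit)
  | seq p q hp hq => exact inferInstanceAs (Finite (p.Label ⊕ q.Label))
  | switch p hp => exact inferInstanceAs (Finite (Option (Σ v, (p v).Label)))
  | loop c p hp => exact inferInstanceAs (Finite (Option p.Label))

variable [DecidableEq K]

/-- `p.Runs a t b`: started in the memory state `a`, the program `p` ends in `b` after at most `t`
steps. -/
inductive Runs : Prog K Γ β σ → Mem K Γ β σ → ℕ → Mem K Γ β σ → Prop where
  | push (k : K) (f : σ → Γ k) (a : Mem K Γ β σ) :
      Runs (.push k f) a 1 ⟨a.var, Function.update a.stk k (f a.var :: a.stk k), a.out⟩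
  | pop (k : K) (f : σ → Option (Γ k) → σ) (a : Mem K Γ β σ) :
      Runs (.pop k f) a 1
        ⟨f a.var (a.stk k).head?, Function.update a.stk k (a.stk k).tail, a.out⟩
  | load (f : σ → σ) (a : Mem K Γ β σ) : Runs (.load f) a 1 ⟨f a.var, a.stk, a.out⟩
  | emit (f : σ → β) (a : Mem K Γ β σ) : Runs (.emit f) a 1 ⟨a.var, a.stk, f a.var :: a.out⟩
  | seq {p q : Prog K Γ β σ} {a b c : Mem K Γ β σ} {t u : ℕ} :
      Runs p a t b → Runs q b u c → Runs (.seq p q) a (t + u) c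
  | switch {p : σ → Prog K Γ β σ} {a b : Mem K Γ β σ} {t : ℕ} :
      Runs (p a.var) a t b → Runs (.switch p) a (t + 1) b
  | loop_exit {c : σ → Bool} {p : Prog K Γ β σ} {a : Mem K Γ β σ} :
      c a.var = false → Runs (.loop c p) a 1 a
  | loop_step {c : σ → Bool} {p : Prog K Γ β σ} {a b d : Mem K Γ β σ} {t u : ℕ} :
      c a.var = true → Runs p a t b → Runs (.loop c p) b u d → Runs (.loop c p) a (t + u + 1) d
  | weaken {p : Prog K Γ β σ} {a b : Mem K Γ β σ} {t u : ℕ} :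
      Runs p a t b → t ≤ u → Runs p a u b

/-! ### Compilation to stack machines and composition with a given machine. -/

section Prepend

variable (M : Turing.FinTM2) (e : β → M.Γ M.k₀)

/-- The alphabets of the stacks of a program together with those of a machine. -/
abbrev JoinAlphabet (Γ : K → Type) (M : Turing.FinTM2) : K ⊕ M.K → Type
  | .inl k => Γ k
  | .inr k => M.Γ k

/-- The compiled program: it writes its output to the input stack of the machine `M`. -/
def code {Λ : Type} : (p : Prog K Γ β σ) → (p.Label → Λ) → Λ → p.Label →
    Turing.TM2.Stmt (JoinAlphabet Γ M) Λ (σ × M.σ)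
  | push k f, _, exit, _ => .push (Sum.inl k) (fun v => f v.1) (.goto fun _ => exit)
  | pop k f, _, exit, _ => .pop (Sum.inl k) (fun v x => (f v.1 x, v.2)) (.goto fun _ => exit)
  | load f, _, exit, _ => .load (fun v => (f v.1, v.2)) (.goto fun _ => exit)
  | emit f, _, exit, _ => .push (Sum.inr M.k₀) (fun v => e (f v.1)) (.goto fun _ => exit)
  | seq p q, emb, _, .inl l => p.code (fun l => emb (.inl l)) (emb (.inr q.entry)) l
  | seq _ q, emb, exit, .inr l => q.code (fun l => emb (.inr l)) exit l
  | switch p, emb, _, none => .goto fun v => emb (some ⟨v.1, (p v.1).entry⟩)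
  | switch p, emb, exit, some ⟨v, l⟩ => (p v).code (fun l => emb (some ⟨v, l⟩)) exit l
  | loop c p, emb, exit, none => .goto fun v => if c v.1 then emb (some p.entry) else exit
  | loop _ p, emb, _, some l => p.code (fun l => emb (some l)) (emb none) l

/-- The joint contents of the stacks of a program and of a machine. -/
def joinStk (S : ∀ k, List (Γ k)) (T : ∀ k, List (M.Γ k)) : ∀ k, List (JoinAlphabet Γ M k)
  | .inl k => S k
  | .inr k => T k

theorem joinStk_update_left (S : ∀ k, List (Γ k)) (T : ∀ k, List (M.Γ k)) (k : K)
    (l : List (Γ k)) :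
    Function.update (joinStk M S T) (Sum.inl k) l = joinStk M (Function.update S k l) T := by
  funext j
  rcases j with j | j
  · by_cases h : j = k
    · subst h; simp [joinStk]
    · rw [Function.update_of_ne (by simpa using h)]
      simp [joinStk, h]
  · rw [Function.update_of_ne (by simp)]
    rfl

theorem joinStk_update_right (S : ∀ k, List (Γ k)) (T : ∀ k, List (M.Γ k)) (k : M.K)
    (l : List (M.Γ k)) :
    Function.update (joinStk M S T) (Sum.inr k) l = joinStk M S (Function.update T k l) := by
  funext j
  rcases j with j | j
  · rw [Function.update_of_ne (by simp)]
    rfl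
  · by_cases h : j = k
    · subst h; simp [joinStk]
    · rw [Function.update_of_ne (by simpa using h)]
      simp [joinStk, h]

/-- The stacks of a machine when only its input stack is non-empty. -/
def inputStk (l : List (M.Γ M.k₀)) : ∀ k, List (M.Γ k) := Function.update (fun _ => []) M.k₀ l

/-- Reachability in a bounded number of steps. -/
def ReachesIn {C : Type} (f : C → Option C) (a : C) (t : ℕ) (b : C) : Prop :=
  ∃ n ≤ t, (flip bind f)^[n] (some a) = some b

theorem ReachesIn.step {C : Type} {f : C → Option C} {a b : C} (h : f a = some b) :
    ReachesIn f a 1 b := ⟨1, le_rfl, h⟩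

theorem ReachesIn.trans {C : Type} {f : C → Option C} {a b c : C} {t u : ℕ}
    (h₁ : ReachesIn f a t b) (h₂ : ReachesIn f b u c) : ReachesIn f a (t + u) c := by
  obtain ⟨n, hn, h₁⟩ := h₁
  obtain ⟨m, hm, h₂⟩ := h₂
  exact ⟨m + n, by omega, by rw [Function.iterate_add_apply, h₁, h₂]⟩

theorem ReachesIn.mono {C : Type} {f : C → Option C} {a b : C} {t u : ℕ}
    (h : ReachesIn f a t b) (htu : t ≤ u) : ReachesIn f a u b := by
  obtain ⟨n, hn, h⟩ := h
  exact ⟨n, hn.trans htu, h⟩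

/-- The configuration of the compiled program at a control point. -/
def cfg {Λ : Type} (l : Λ) (w : M.σ) (a : Mem K Γ β σ) :
    Turing.TM2.Cfg (JoinAlphabet Γ M) Λ (σ × M.σ) :=
  ⟨some l, (a.var, w), joinStk M a.stk (inputStk M (a.out.map e))⟩

/-- Induction on the run. The embedding of labels and the exit label stay general, because a
subprogram sits inside a larger set of labels and exits to the entry of whatever follows it. Every
primitive and every test is one machine step, so sequencing costs nothing extra. -/
theorem Runs.reachesIn {Λ : Type} {m : Λ → Turing.TM2.Stmt (JoinAlphabet Γ M) Λ (σ × M.σ)}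
    (w : M.σ) {p : Prog K Γ β σ} {a b : Mem K Γ β σ} {t : ℕ} (h : p.Runs a t b) :
    ∀ (emb : p.Label → Λ) (exit : Λ), (∀ l, m (emb l) = p.code M e emb exit l) →
      ReachesIn (Turing.TM2.step m) (cfg M e (emb p.entry) w a) t (cfg M e exit w b) := by
  induction h with
  | push k f a =>
    intro emb exit hm
    refine ReachesIn.step ?_
    simp only [cfg, Turing.TM2.step, hm, code, Turing.TM2.stepAux, joinStk_update_left]
    rfl
  | pop k f a =>
    intro emb exit hm
    refine ReachesIn.step ?_
    simp only [cfg, Turing.TM2.step, hm, code, Turing.TM2.stepAux, joinStk_update_left]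
    rfl
  | load f a =>
    intro emb exit hm
    refine ReachesIn.step ?_
    simp only [cfg, Turing.TM2.step, hm, code, Turing.TM2.stepAux]
  | emit f a =>
    intro emb exit hm
    refine ReachesIn.step ?_
    simp only [cfg, Turing.TM2.step, hm, code, Turing.TM2.stepAux, joinStk_update_right]
    simp [joinStk, inputStk]
  | @seq p q a b c t u _ _ ih₁ ih₂ =>
    intro emb exit hm
    exact (ih₁ (fun l => emb (.inl l)) (emb (.inr q.entry)) fun l => hm (.inl l)).trans
      (ih₂ (fun l => emb (.inr l)) exit fun l => hm (.inr l))
  | @switch p a b t _ ih =>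
    intro emb exit hm
    rw [add_comm]
    refine (ReachesIn.step ?_).trans
      (ih (fun l => emb (some ⟨a.var, l⟩)) exit fun l => hm (some ⟨a.var, l⟩))
    change some (Turing.TM2.stepAux (m (emb none)) (a.var, w) _) = _
    rw [hm none]
    rfl
  | @loop_exit c p a hc =>
    intro emb exit hm
    refine ReachesIn.step ?_
    change some (Turing.TM2.stepAux (m (emb none)) (a.var, w) _) = _
    rw [hm none]
    simp [code, cfg, hc]
  | @loop_step c p a b d t u hc _ _ ih₁ ih₂ =>
    intro emb exit hm
    rw [show t + u + 1 = 1 + (t + u) by ring]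
    refine (ReachesIn.step ?_).trans
      ((ih₁ (fun l => emb (some l)) (emb none) fun l => hm (some l)).trans (ih₂ emb exit hm))
    change some (Turing.TM2.stepAux (m (emb none)) (a.var, w) _) = _
    rw [hm none]
    simp [code, cfg, hc]
  | weaken _ htu ih =>
    intro emb exit hm
    exact (ih emb exit hm).mono htu

/-- A statement of the machine `M`, run next to the stacks of a program. -/
def liftStmt {Λ : Type} (emb : M.Λ → Λ) : Turing.TM2.Stmt M.Γ M.Λ M.σ →
    Turing.TM2.Stmt (JoinAlphabet Γ M) Λ (σ × M.σ)
  | .push k f q => .push (Sum.inr k) (fun v => f v.2) (liftStmt emb q)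
  | .peek k f q => .peek (Sum.inr k) (fun v x => (v.1, f v.2 x)) (liftStmt emb q)
  | .pop k f q => .pop (Sum.inr k) (fun v x => (v.1, f v.2 x)) (liftStmt emb q)
  | .load f q => .load (fun v => (v.1, f v.2)) (liftStmt emb q)
  | .branch f q r => .branch (fun v => f v.2) (liftStmt emb q) (liftStmt emb r)
  | .goto f => .goto fun v => emb (f v.2)
  | .halt => .halt

/-- A configuration of the machine `M`, seen next to the stacks of a program. -/
def liftCfg {Λ : Type} (emb : M.Λ → Λ) (v : σ) (S : ∀ k, List (Γ k))
    (c : Turing.TM2.Cfg M.Γ M.Λ M.σ) : Turing.TM2.Cfg (JoinAlphabet Γ M) Λ (σ × M.σ) :=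
  ⟨c.l.map emb, (v, c.var), joinStk M S c.stk⟩

theorem stepAux_liftStmt {Λ : Type} (emb : M.Λ → Λ) (v : σ) (S : ∀ k, List (Γ k))
    (q : Turing.TM2.Stmt M.Γ M.Λ M.σ) (w : M.σ) (T : ∀ k, List (M.Γ k)) :
    Turing.TM2.stepAux (liftStmt M emb q) (v, w) (joinStk M S T) =
      liftCfg M emb v S (Turing.TM2.stepAux q w T) := by
  induction q generalizing w T with
  | push k f q ih =>
    simp only [liftStmt, Turing.TM2.stepAux, joinStk_update_right]
    exact ih _ _
  | peek k f q ih => exact ih _ _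
  | pop k f q ih =>
    simp only [liftStmt, Turing.TM2.stepAux, joinStk_update_right]
    exact ih _ _
  | load f q ih => exact ih _ _
  | branch f q r ihq ihr =>
    simp only [liftStmt, Turing.TM2.stepAux]
    cases f w
    · exact ihr _ _
    · exact ihq _ _
  | goto f => rfl
  | halt => rfl

/-- The lifted machine and `M` run in lockstep. Working with optional configurations covers halting,
where both sides become `none`. -/
theorem iterate_bind_liftCfg {Λ : Type}
    {m : Λ → Turing.TM2.Stmt (JoinAlphabet Γ M) Λ (σ × M.σ)} (emb : M.Λ → Λ) (v : σ)
    (S : ∀ k, List (Γ k)) (hm : ∀ l, m (emb l) = liftStmt M emb (M.m l)) (n : ℕ)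
    (c : Option (Turing.TM2.Cfg M.Γ M.Λ M.σ)) :
    (flip bind (Turing.TM2.step m))^[n] (c.map (liftCfg M emb v S)) =
      ((flip bind (Turing.TM2.step M.m))^[n] c).map (liftCfg M emb v S) := by
  induction n generalizing c with
  | zero => rfl
  | succ n ih =>
    rw [Function.iterate_succ_apply, Function.iterate_succ_apply, ← ih]
    congr 1
    rcases c with _ | ⟨_ | l, w, T⟩
    · rfl
    · rfl
    · change some (Turing.TM2.stepAux (m (emb l)) (v, w) (joinStk M S T)) = _
      rw [hm, stepAux_liftStmt]
      rfl

end Prepend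

/-- The stacks of a program when only the stack `k₀` is non-empty. -/
def single (k₀ : K) (l : List (Γ k₀)) : ∀ k, List (Γ k) := Function.update (fun _ => []) k₀ l

variable [Fintype K] [Finite σ] {α γ : Type}

/-- The machine that runs a program and then the machine `M` on the output of the program. -/
noncomputable def prepend (M : Turing.TM2ComputableAux β γ) (p : Prog K Γ β σ) (k₀ : K)
    [Fintype (Γ k₀)] (e : Γ k₀ ≃ α) (v₀ : σ) : Turing.TM2ComputableAux α γ :=
  haveI := p.finite_label
  haveI := M.tm.kFin
  haveI := M.tm.ΛFin
  haveI := M.tm.σFin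
  { tm :=
      { K := K ⊕ M.tm.K
        kDecidableEq := inferInstance
        kFin := inferInstance
        k₀ := .inl k₀
        k₁ := .inr M.tm.k₁
        Γ := JoinAlphabet Γ M.tm
        Λ := p.Label ⊕ M.tm.Λ
        main := .inl p.entry
        ΛFin := Fintype.ofFinite _
        σ := σ × M.tm.σ
        initialState := (v₀, M.tm.initialState)
        σFin := Fintype.ofFinite _
        Γk₀Fin := inferInstanceAs (Fintype (Γ k₀))
        m := Sum.elim (p.code M.tm M.inputAlphabet.symm Sum.inl (.inr M.tm.main))
          fun l => liftStmt M.tm Sum.inr (M.tm.m l) }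
    inputAlphabet := e
    outputAlphabet := M.outputAlphabet }

/-- The program has to end in `v₀` with empty stacks because a halting configuration prescribes the
initial state and allows content on the output stack only. -/
theorem Runs.outputsInTime_prepend (M : Turing.TM2ComputableAux β γ) {p : Prog K Γ β σ} {k₀ : K}
    [Fintype (Γ k₀)] (e : Γ k₀ ≃ α) {v₀ : σ} {x : List α} {y : List β} {z : List γ} {t u : ℕ}
    (h : p.Runs ⟨v₀, single k₀ (x.map e.symm), []⟩ t ⟨v₀, fun _ => [], y⟩)
    (hM : Nonempty (Turing.TM2OutputsInTime M.tm (y.map M.inputAlphabet.symm)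
      (some (z.map M.outputAlphabet.symm)) u)) :
    Nonempty (Turing.TM2OutputsInTime (p.prepend M k₀ e v₀).tm
      (x.map (p.prepend M k₀ e v₀).inputAlphabet.symm)
      (some (z.map (p.prepend M k₀ e v₀).outputAlphabet.symm)) (t + u)) := by
  obtain ⟨⟨n, hn⟩, hnu⟩ := hM
  have h₁ := h.reachesIn M.tm M.inputAlphabet.symm (m := (p.prepend M k₀ e v₀).tm.m)
    M.tm.initialState Sum.inl (.inr M.tm.main) fun l => rfl
  have h₂ := iterate_bind_liftCfg M.tm (m := (p.prepend M k₀ e v₀).tm.m) Sum.inr v₀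
    (fun k => ([] : List (Γ k))) (fun l => rfl) n
    (some (Turing.initList M.tm (y.map M.inputAlphabet.symm)))
  have h₃ : ReachesIn (Turing.TM2.step (p.prepend M k₀ e v₀).tm.m)
      (liftCfg M.tm Sum.inr v₀ (fun k => ([] : List (Γ k)))
        (Turing.initList M.tm (y.map M.inputAlphabet.symm))) u
      (liftCfg M.tm Sum.inr v₀ (fun k => ([] : List (Γ k)))
        (Turing.haltList M.tm (z.map M.outputAlphabet.symm))) := by
    refine ⟨n, hnu, ?_⟩
    erw [h₂]
    erw [hn]
    rfl
  -- The output already lies on the input stack of `M` in the right order, so the exit configuration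
  -- of the program is the initial configuration of `M`; nothing is copied.
  have hmid : cfg M.tm M.inputAlphabet.symm (Sum.inr M.tm.main : p.Label ⊕ M.tm.Λ)
      M.tm.initialState ⟨v₀, fun k => ([] : List (Γ k)), y⟩ =
      liftCfg M.tm Sum.inr v₀ (fun k => ([] : List (Γ k)))
        (Turing.initList M.tm (y.map M.inputAlphabet.symm)) := by
    unfold cfg liftCfg
    congr 1
    funext k
    rcases k with k | k
    · rfl
    · simp only [joinStk, Turing.initList, inputStk]
      by_cases hk : k = M.tm.k₀
      · subst hk; simp
      · simp [hk]
  erw [hmid] at h₁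
  have hinit : (Turing.initList (p.prepend M k₀ e v₀).tm (x.map e.symm) :
      Turing.TM2.Cfg (JoinAlphabet Γ M.tm) (p.Label ⊕ M.tm.Λ) (σ × M.tm.σ)) =
      cfg M.tm M.inputAlphabet.symm (Sum.inl p.entry) M.tm.initialState
        ⟨v₀, single k₀ (x.map e.symm), []⟩ := by
    unfold cfg Turing.initList
    congr 1
    funext k
    rcases k with k | k
    · simp only [joinStk, single]
      by_cases hk : k = k₀
      · subst hk; simp [prepend]; rfl
      · simp [hk, prepend]
    · simp [joinStk, prepend, inputStk]
  have hhalt : (Turing.haltList (p.prepend M k₀ e v₀).tm (z.map M.outputAlphabet.symm) :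
      Turing.TM2.Cfg (JoinAlphabet Γ M.tm) (p.Label ⊕ M.tm.Λ) (σ × M.tm.σ)) =
      liftCfg M.tm Sum.inr v₀ (fun k => ([] : List (Γ k)))
        (Turing.haltList M.tm (z.map M.outputAlphabet.symm)) := by
    unfold liftCfg Turing.haltList
    congr 1
    funext k
    rcases k with k | k
    · simp [joinStk, prepend]
    · simp only [joinStk]
      by_cases hk : k = M.tm.k₁
      · subst hk; simp [prepend]; rfl
      · simp [hk, prepend]
  obtain ⟨N, hN, hr⟩ := h₁.trans h₃
  erw [← hinit, ← hhalt] at hr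
  exact ⟨⟨⟨N, hr⟩, hN⟩⟩

end Prog

/-! ### Iteration over a fixed finite list. -/

namespace Prog

variable {K : Type} {Γ : K → Type} {β σ : Type}

/-- The program that runs `p i` for all `i` in a list, in order. -/
def forList {ι : Type} (l : List ι) (p : ι → Prog K Γ β σ) : Prog K Γ β σ :=
  l.foldr (fun i q => .seq (p i) q) (.load id)

variable [DecidableEq K]

theorem Runs.congr {p : Prog K Γ β σ} {a b b' : Mem K Γ β σ} {t : ℕ} (h : p.Runs a t b)
    (hb : b = b') : p.Runs a t b' := hb ▸ h

theorem Runs.congr_weaken {p : Prog K Γ β σ} {a b b' : Mem K Γ β σ} {t u : ℕ} (h : p.Runs a t b)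
    (hb : b = b') (htu : t ≤ u) : p.Runs a u b' := (h.congr hb).weaken htu

/-- Later words land in front of earlier ones, hence the reversal. The additional step is the
closing `load id`. -/
theorem Runs.forList {ι : Type} {p : ι → Prog K Γ β σ} {l : List ι} {v : σ}
    {S : ∀ k, List (Γ k)} {t : ℕ} {g : ι → List β}
    (h : ∀ i ∈ l, ∀ o, (p i).Runs ⟨v, S, o⟩ t ⟨v, S, g i ++ o⟩) (o : List β) :
    (Prog.forList l p).Runs ⟨v, S, o⟩ (l.length * t + 1) ⟨v, S, (l.map g).reverse.flatten ++ o⟩ := by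
  induction l generalizing o with
  | nil => simpa [Prog.forList] using Runs.load id (⟨v, S, o⟩ : Mem K Γ β σ)
  | cons i l ih =>
    refine ((h i (by simp) o).seq (ih (fun j hj => h j (by simp [hj])) _)).congr_weaken ?_ ?_
    · simp
    · simp only [List.length_cons]; linarith

end Prog

/-! ### Items and the matrix of a list of items -/

/-- The letters of a word that describes a list of items. -/
inductive ItemSymbol (T : Type) where
  | tag : T → ItemSymbol T
  | tick : ItemSymbol T
  | sep : ItemSymbol T

/-- An item has a tag and three numbers. -/
structure Item (T : Type) where
  tag : T
  slot : Fin 3 → ℕ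

namespace Item

variable {T : Type}

/-- A number in unary. -/
def slotWord (T : Type) (n : ℕ) : List (ItemSymbol T) :=
  List.replicate n ItemSymbol.tick ++ [ItemSymbol.sep]

/-- The three numbers of an item in unary. -/
def slotsWord (u : Item T) : List (ItemSymbol T) :=
  slotWord T (u.slot 2) ++ (slotWord T (u.slot 1) ++ slotWord T (u.slot 0))

/-- The word of an item. -/
def word (u : Item T) : List (ItemSymbol T) := ItemSymbol.tag u.tag :: u.slotsWord

theorem slotWord_zero : slotWord T 0 = [ItemSymbol.sep] := rfl

theorem slotWord_succ (n : ℕ) : slotWord T (n + 1) = ItemSymbol.tick :: slotWord T n := rfl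

theorem length_slotWord (n : ℕ) : (slotWord T n).length = n + 1 := by simp [slotWord]

theorem length_word (u : Item T) : u.word.length = u.slot 0 + u.slot 1 + u.slot 2 + 4 := by
  simp only [word, slotsWord, List.length_cons, List.length_append, length_slotWord]
  omega

end Item

/-! ### The program that writes the matrix of a list of items -/

namespace MatrixProg

variable {T : Type}

/-- The tapes of the program: two tapes, each split at its head. -/
inductive Stack where
  | a | a' | b | b'
  deriving DecidableEq

instance : Fintype Stack := ⟨{.a, .a', .b, .b'}, fun k => by cases k <;> simp⟩

/-- The finite state of the program: two letters read last, the slots in which the two current items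
agree, and their tags. -/
structure State (T : Type) where
  x : Option (ItemSymbol T)
  y : Option (ItemSymbol T)
  share : Fin 3 → Bool
  tu : T
  tv : T

instance [Finite T] : Finite (ItemSymbol T) := by
  refine Finite.of_injective (β := Option (Option T)) (fun l => match l with
    | .tag t => some (some t)
    | .tick => some none
    | .sep => none) ?_
  intro l m h
  cases l <;> cases m <;> simp_all

instance [Finite T] : Finite (State T) := by
  refine Finite.of_injective
    (β := Option (ItemSymbol T) × Option (ItemSymbol T) × (Fin 3 → Bool) × T × T)
    (fun v => (v.x, v.y, v.share, v.tu, v.tv)) ?_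
  rintro ⟨⟩ ⟨⟩ h
  simp_all

/-- The tapes with the given contents. -/
def tapes (a a' b b' : List (ItemSymbol T)) : Stack → List (ItemSymbol T)
  | .a => a
  | .a' => a'
  | .b => b
  | .b' => b'

section tapes

variable (a a' b b' l : List (ItemSymbol T))

@[simp] theorem tapes_a : tapes a a' b b' .a = a := rfl
@[simp] theorem tapes_a' : tapes a a' b b' .a' = a' := rfl
@[simp] theorem tapes_b : tapes a a' b b' .b = b := rfl
@[simp] theorem tapes_b' : tapes a a' b b' .b' = b' := rfl

@[simp] theorem update_tapes_a :
    Function.update (tapes a a' b b') .a l = tapes l a' b b' := by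
  funext k; cases k <;> rfl
@[simp] theorem update_tapes_a' :
    Function.update (tapes a a' b b') .a' l = tapes a l b b' := by
  funext k; cases k <;> rfl
@[simp] theorem update_tapes_b :
    Function.update (tapes a a' b b') .b l = tapes a a' l b' := by
  funext k; cases k <;> rfl
@[simp] theorem update_tapes_b' :
    Function.update (tapes a a' b b') .b' l = tapes a a' b l := by
  funext k; cases k <;> rfl

end tapes

/-- Programs on these tapes. -/
abbrev MProg (T : Type) := Prog Stack (fun _ => ItemSymbol T) GraphSymbol (State T)

/-- The test for a separator. -/
def isSep : Option (ItemSymbol T) → Bool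
  | some .sep => true
  | _ => false

/-- The test for a tag. -/
def isTag : Option (ItemSymbol T) → Bool
  | some (.tag _) => true
  | _ => false

/-- The tag that was read. -/
def getTag [Inhabited T] : Option (ItemSymbol T) → T
  | some (.tag t) => t
  | _ => default

@[simp] theorem isSep_none : isSep (none : Option (ItemSymbol T)) = false := rfl
@[simp] theorem isSep_sep : isSep (some (ItemSymbol.sep : ItemSymbol T)) = true := rfl
@[simp] theorem isSep_tick : isSep (some (ItemSymbol.tick : ItemSymbol T)) = false := rfl
@[simp] theorem isTag_tag (t : T) : isTag (some (ItemSymbol.tag t)) = true := rfl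
@[simp] theorem getTag_tag [Inhabited T] (t : T) : getTag (some (ItemSymbol.tag t)) = t := rfl

/-- Pop a letter into the register `x`. -/
def popX (k : Stack) : MProg T := .pop k fun v l => { v with x := l }

/-- Pop a letter into the register `y`. -/
def popY (k : Stack) : MProg T := .pop k fun v l => { v with y := l }

/-- Push the letter in the register `x`. -/
def pushX (k : Stack) : MProg T := .push k fun v => v.x.getD .sep

/-- Push the letter in the register `y`. -/
def pushY (k : Stack) : MProg T := .push k fun v => v.y.getD .sep

theorem runs_popX (k : Stack) (v : State T) (S : Stack → List (ItemSymbol T))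
    (o : List GraphSymbol) :
    (popX k).Runs ⟨v, S, o⟩ 1 ⟨{ v with x := (S k).head? }, Function.update S k (S k).tail, o⟩ :=
  .pop _ _ _

theorem runs_popY (k : Stack) (v : State T) (S : Stack → List (ItemSymbol T))
    (o : List GraphSymbol) :
    (popY k).Runs ⟨v, S, o⟩ 1 ⟨{ v with y := (S k).head? }, Function.update S k (S k).tail, o⟩ :=
  .pop _ _ _

theorem runs_pushX (k : Stack) (v : State T) (S : Stack → List (ItemSymbol T))
    (o : List GraphSymbol) :
    (pushX k).Runs ⟨v, S, o⟩ 1 ⟨v, Function.update S k (v.x.getD .sep :: S k), o⟩ :=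
  .push _ _ _

theorem runs_pushY (k : Stack) (v : State T) (S : Stack → List (ItemSymbol T))
    (o : List GraphSymbol) :
    (pushY k).Runs ⟨v, S, o⟩ 1 ⟨v, Function.update S k (v.y.getD .sep :: S k), o⟩ :=
  .push _ _ _

/-- Move the contents of a stack to another stack. -/
def move (k j : Stack) : MProg T :=
  .seq (popX k) (.loop (fun v => v.x.isSome) (.seq (pushX j) (popX k)))

theorem runs_move {k j : Stack} (hkj : k ≠ j) (v : State T) (S : Stack → List (ItemSymbol T))
    (o : List GraphSymbol) :
    (move k j).Runs ⟨v, S, o⟩ (3 * (S k).length + 2)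
      ⟨{ v with x := none },
        Function.update (Function.update S k []) j ((S k).reverse ++ S j), o⟩ := by
  -- Loop invariant: the register `x` holds the head of the remaining word and the stack holds its
  -- tail, so the test on `x` detects the end. The later reading loops use the same look-ahead.
  suffices h : ∀ (l : List (ItemSymbol T)) (v : State T) (S : Stack → List (ItemSymbol T)),
      S k = l.tail → v.x = l.head? →
      (Prog.loop (fun v => v.x.isSome) (.seq (pushX j) (popX k)) : MProg T).Runs ⟨v, S, o⟩
        (3 * l.length + 1) ⟨{ v with x := none },
          Function.update (Function.update S k []) j (l.reverse ++ S j), o⟩ by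
    refine ((runs_popX k v S o).seq (h (S k) _ _ (by simp) rfl)).congr_weaken ?_ (by omega)
    simp [Function.update_of_ne hkj.symm]
  intro l
  induction l with
  | nil =>
    intro v S hS hv
    refine (Prog.Runs.loop_exit (by simp [hv])).congr ?_
    simp only [List.head?_nil, List.tail_nil] at hv hS
    simp only [List.reverse_nil, List.nil_append, Mem.mk.injEq, and_true]
    refine ⟨by rw [← hv], ?_⟩
    rw [← hS, Function.update_eq_self, Function.update_eq_self]
  | cons a l ih =>
    intro v S hS hv
    simp only [List.tail_cons, List.head?_cons] at hS hv
    refine (Prog.Runs.loop_step (by simp [hv]) ((runs_pushX j v S o).seq (runs_popX k _ _ o))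
      (ih _ _ ?_ ?_)).congr_weaken ?_ ?_
    · simp [Function.update_of_ne hkj, hS]
    · simp [Function.update_of_ne hkj, hS]
    · simp only [hv, Function.update_of_ne hkj, Function.update_of_ne hkj.symm,
        Function.update_self, Mem.mk.injEq, and_true, true_and]
      funext i
      by_cases hi : i = j
      · subst hi; simp
      · simp only [Function.update_of_ne hi]
        by_cases hik : i = k
        · subst hik; simp
        · simp [Function.update_of_ne hik, Function.update_of_ne hi]
    · simp only [List.length_cons]; omega

/-- Read a letter of the first tape, unless the separator was reached. -/
def advanceA : MProg T := .switch fun v =>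
  if isSep v.x then .load id else .seq (popX .a) (pushX .a')

/-- Read a letter of the second tape, unless the separator was reached. -/
def advanceB : MProg T := .switch fun v =>
  if isSep v.y then .load id else .seq (popY .b) (pushY .b')

theorem runs_advanceA_sep {v : State T} (hv : isSep v.x = true) (S : Stack → List (ItemSymbol T))
    (o : List GraphSymbol) : advanceA.Runs ⟨v, S, o⟩ 3 ⟨v, S, o⟩ :=
  .switch (by simpa [hv] using (Prog.Runs.load id _).weaken (by omega))

theorem runs_advanceB_sep {v : State T} (hv : isSep v.y = true) (S : Stack → List (ItemSymbol T))
    (o : List GraphSymbol) : advanceB.Runs ⟨v, S, o⟩ 3 ⟨v, S, o⟩ :=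
  .switch (by simpa [hv] using (Prog.Runs.load id _).weaken (by omega))

theorem runs_advanceA {v : State T} (hv : isSep v.x = false) (l : ItemSymbol T)
    (a a' b b' : List (ItemSymbol T)) (o : List GraphSymbol) :
    advanceA.Runs ⟨v, tapes (l :: a) a' b b', o⟩ 3
      ⟨{ v with x := some l }, tapes a (l :: a') b b', o⟩ := by
  refine Prog.Runs.switch (t := 2) ?_
  simp only [hv]
  exact ((runs_popX _ _ _ _).seq (runs_pushX _ _ _ _)).congr (by simp)

theorem runs_advanceB {v : State T} (hv : isSep v.y = false) (l : ItemSymbol T)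
    (a a' b b' : List (ItemSymbol T)) (o : List GraphSymbol) :
    advanceB.Runs ⟨v, tapes a a' (l :: b) b', o⟩ 3
      ⟨{ v with y := some l }, tapes a a' b (l :: b'), o⟩ := by
  refine Prog.Runs.switch (t := 2) ?_
  simp only [hv]
  exact ((runs_popY _ _ _ _).seq (runs_pushY _ _ _ _)).congr (by simp)

/-- Record whether the two tapes reach their separators simultaneously. -/
def record (j : Fin 3) (v : State T) : State T :=
  { v with share := Function.update v.share j (v.share j && (isSep v.x == isSep v.y)) }

/-- The main loop of the comparison of two slots. -/
def compareLoop (j : Fin 3) : MProg T :=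
  .loop (fun v => !(isSep v.x && isSep v.y)) (.seq advanceA (.seq advanceB (.load (record j))))

/-- The second slot has ended first. `record` is a conjunction, so the flag, already false, stays
false while the rest of the first slot is read. A round costs 8 steps: two advances of 3, the record
and the test. -/
theorem runs_compareLoop_left (j : Fin 3) (m : ℕ) (v : State T) (hx : isSep v.x = false)
    (hy : v.y = some .sep) (hs : v.share j = false)
    (a a' b b' : List (ItemSymbol T)) (o : List GraphSymbol) :
    (compareLoop j).Runs ⟨v, tapes (Item.slotWord T m ++ a) a' b b', o⟩ (8 * (m + 1) + 1)
      ⟨{ v with x := some .sep },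
        tapes a ((Item.slotWord T m).reverse ++ a') b b', o⟩ := by
  have hu : Function.update v.share j false = v.share := by rw [← hs, Function.update_eq_self]
  induction m generalizing v a' with
  | zero =>
    refine (Prog.Runs.loop_step (by simp [hx]) ((runs_advanceA hx .sep a a' b b' o).seq
      ((runs_advanceB_sep (by simp [hy]) _ o).seq (.load _ _)))
      (Prog.Runs.loop_exit ?_)).congr_weaken ?_ ?_
    · simp [record, hy]
    · simp [record, hs, Item.slotWord_zero, hu]
    · omega
  | succ m ih =>
    refine (Prog.Runs.loop_step (by simp [hx]) ((runs_advanceA hx .tick _ a' b b' o).seq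
      ((runs_advanceB_sep (by simp [hy]) _ o).seq (.load _ _)))
      (ih _ ?_ ?_ ?_ _ ?_)).congr_weaken ?_ ?_
    · simp [record]
    · simp [record, hy]
    · simp [record, hs]
    · simp [record, hs]
    · simp [record, hs, Item.slotWord_succ, hu]
    · omega

theorem runs_compareLoop_right (j : Fin 3) (m : ℕ) (v : State T) (hx : v.x = some .sep)
    (hy : isSep v.y = false) (hs : v.share j = false)
    (a a' b b' : List (ItemSymbol T)) (o : List GraphSymbol) :
    (compareLoop j).Runs ⟨v, tapes a a' (Item.slotWord T m ++ b) b', o⟩ (8 * (m + 1) + 1)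
      ⟨{ v with y := some .sep },
        tapes a a' b ((Item.slotWord T m).reverse ++ b'), o⟩ := by
  have hu : Function.update v.share j false = v.share := by rw [← hs, Function.update_eq_self]
  induction m generalizing v b' with
  | zero =>
    refine (Prog.Runs.loop_step (by simp [hy]) ((runs_advanceA_sep (by simp [hx]) _ o).seq
      ((runs_advanceB hy .sep a a' b b' o).seq (.load _ _)))
      (Prog.Runs.loop_exit ?_)).congr_weaken ?_ ?_
    · simp [record, hx]
    · simp [record, hs, Item.slotWord_zero, hu]
    · omega
  | succ m ih =>
    refine (Prog.Runs.loop_step (by simp [hy]) ((runs_advanceA_sep (by simp [hx]) _ o).seq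
      ((runs_advanceB hy .tick a a' _ b' o).seq (.load _ _)))
      (ih _ ?_ ?_ ?_ _ ?_)).congr_weaken ?_ ?_
    · simp [record, hx]
    · simp [record]
    · simp [record, hs]
    · simp [record, hs]
    · simp [record, hs, Item.slotWord_succ, hu]
    · omega

/-- Both slots are read in lockstep, and the flag survives exactly if the separators arrive in the
same round. If one arrives earlier, the one-sided lemmas finish the other slot. -/
theorem runs_compareLoop (j : Fin 3) (m n : ℕ) (v : State T) (hx : isSep v.x = false)
    (hy : isSep v.y = false) (a a' b b' : List (ItemSymbol T)) (o : List GraphSymbol) :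
    (compareLoop j).Runs
      ⟨v, tapes (Item.slotWord T m ++ a) a' (Item.slotWord T n ++ b) b', o⟩
      (8 * (m + n + 1) + 1)
      ⟨{ v with x := some .sep, y := some .sep,
                share := Function.update v.share j (v.share j && decide (m = n)) },
        tapes a ((Item.slotWord T m).reverse ++ a') b ((Item.slotWord T n).reverse ++ b'), o⟩ := by
  induction m generalizing n v a' b' with
  | zero =>
    cases n with
    | zero =>
      refine (Prog.Runs.loop_step (by simp [hx]) ((runs_advanceA hx .sep a a' _ b' o).seq
        ((runs_advanceB (v := { v with x := some .sep }) hy .sep a _ b b' o).seq (.load _ _)))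
        (Prog.Runs.loop_exit ?_)).congr_weaken ?_ ?_
      · simp [record]
      · simp [record, Item.slotWord_zero]
      · omega
    | succ n =>
      refine (Prog.Runs.loop_step (by simp [hx]) ((runs_advanceA hx .sep a a' _ b' o).seq
        ((runs_advanceB (v := { v with x := some .sep }) hy .tick a _ (Item.slotWord T n ++ b) b' o).seq (.load _ _)))
        (runs_compareLoop_right j n _ ?_ ?_ ?_ _ _ _ _ _)).congr_weaken ?_ ?_
      · simp [record]
      · simp [record]
      · simp [record]
      · simp [record, Item.slotWord_succ, Item.slotWord_zero]
      · omega
  | succ m ih =>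
    cases n with
    | zero =>
      refine (Prog.Runs.loop_step (by simp [hx]) ((runs_advanceA hx .tick
        (Item.slotWord T m ++ a) a' _ b' o).seq
        ((runs_advanceB (v := { v with x := some .tick }) hy .sep _ _ b b' o).seq (.load _ _)))
        (runs_compareLoop_left j m _ ?_ ?_ ?_ _ _ _ _ _)).congr_weaken ?_ ?_
      · simp [record]
      · simp [record]
      · simp [record]
      · simp [record, Item.slotWord_succ, Item.slotWord_zero]
      · omega
    | succ n =>
      refine (Prog.Runs.loop_step (by simp [hx]) ((runs_advanceA hx .tick
        (Item.slotWord T m ++ a) a' _ b' o).seq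
        ((runs_advanceB (v := { v with x := some .tick }) hy .tick _ _ (Item.slotWord T n ++ b) b' o).seq (.load _ _)))
        (ih n _ ?_ ?_ _ _)).congr_weaken ?_ ?_
      · simp [record]
      · simp [record]
      · simp [record, Item.slotWord_succ]
      · omega

/-- The comparison of two slots. -/
def compareSlot (j : Fin 3) : MProg T :=
  .seq (.load fun v => { v with x := none, y := none, share := Function.update v.share j true })
    (compareLoop j)

theorem runs_compareSlot (j : Fin 3) (m n : ℕ) (v : State T)
    (a a' b b' : List (ItemSymbol T)) (o : List GraphSymbol) :
    (compareSlot j).Runs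
      ⟨v, tapes (Item.slotWord T m ++ a) a' (Item.slotWord T n ++ b) b', o⟩
      (8 * (m + n + 1) + 2)
      ⟨{ v with x := some .sep, y := some .sep,
                share := Function.update v.share j (decide (m = n)) },
        tapes a ((Item.slotWord T m).reverse ++ a') b ((Item.slotWord T n).reverse ++ b'), o⟩ := by
  refine ((Prog.Runs.load _ _).seq (runs_compareLoop j m n _ ?_ ?_ a a' b b' o)).congr_weaken ?_ ?_
  · rfl
  · rfl
  · simp
  · omega

/-- The return to the tag of the current item of the first tape. -/
def rewindItem : MProg T :=
  .seq (.load fun v => { v with x := none })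
    (.loop (fun v => !isTag v.x) (.seq (popX .a') (pushX .a)))

/-- Only the first letter of an item is a tag, so walking back to the nearest tag stops exactly at
the start of the item. -/
theorem runs_rewindItem (v : State T) (t : T) (l : List (ItemSymbol T))
    (hl : ∀ s ∈ l, isTag (some s) = false) (a a' b b' : List (ItemSymbol T))
    (o : List GraphSymbol) :
    rewindItem.Runs ⟨v, tapes a (l ++ .tag t :: a') b b', o⟩ (3 * l.length + 5)
      ⟨{ v with x := some (.tag t) }, tapes (.tag t :: l.reverse ++ a) a' b b', o⟩ := by
  suffices h : ∀ (v : State T) (a : List (ItemSymbol T)), isTag v.x = false →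
      (Prog.loop (fun v => !isTag v.x) (.seq (popX .a') (pushX .a)) : MProg T).Runs
        ⟨v, tapes a (l ++ .tag t :: a') b b', o⟩ (3 * l.length + 4)
        ⟨{ v with x := some (.tag t) }, tapes (.tag t :: l.reverse ++ a) a' b b', o⟩ by
    exact ((Prog.Runs.load _ _).seq (h _ a rfl)).congr_weaken rfl (by omega)
  induction l with
  | nil =>
    intro v a hv
    refine (Prog.Runs.loop_step (by simp [hv]) ((runs_popX _ _ _ _).seq (runs_pushX _ _ _ _))
      (Prog.Runs.loop_exit ?_)).congr_weaken ?_ ?_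
    · simp
    · simp
    · simp
  | cons s l ih =>
    intro v a hv
    refine (Prog.Runs.loop_step (by simp [hv])
      (((runs_popX _ _ _ _).seq (runs_pushX _ _ _ _)).congr (b' :=
        ⟨{ v with x := some s }, tapes (s :: a) (l ++ .tag t :: a') b b', o⟩) ?_)
      (ih (fun r hr => hl r (by simp [hr])) _ _ ?_)).congr_weaken ?_ ?_
    · simp
    · exact hl s (by simp)
    · simp
    · simp only [List.length_cons]; omega

theorem isTag_slotWord {n : ℕ} {s : ItemSymbol T} (hs : s ∈ Item.slotWord T n) :
    isTag (some s) = false := by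
  simp only [Item.slotWord, List.mem_append, List.mem_replicate, List.mem_singleton] at hs
  rcases hs with ⟨_, rfl⟩ | rfl <;> rfl

theorem isTag_slotsWord {u : Item T} {s : ItemSymbol T} (hs : s ∈ u.slotsWord) :
    isTag (some s) = false := by
  simp only [Item.slotsWord, List.mem_append] at hs
  rcases hs with hs | hs | hs <;> exact isTag_slotWord hs

/-- The comparison of the current items of the two tapes, where the tag of the second one was
already read. Only the second tape moves on. -/
def compareItem [Inhabited T] : MProg T :=
  .seq (.load fun v => { v with tv := getTag v.y }) <|
  .seq (pushY .b') <|
  .seq (popX .a) <|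
  .seq (pushX .a') <|
  .seq (compareSlot 2) <|
  .seq (compareSlot 1) <|
  .seq (compareSlot 0) <|
  rewindItem

/-- The first tape is rewound so that the same item can meet the next one on the second tape.
Comparing costs 8 steps per letter of either item and rewinding 3 per letter of the first, whence 11
and 8. -/
theorem runs_compareItem [Inhabited T] (u w : Item T) (v : State T)
    (hv : v.y = some (.tag w.tag)) (a a' b b' : List (ItemSymbol T)) (o : List GraphSymbol) :
    compareItem.Runs ⟨v, tapes (u.word ++ a) a' (w.slotsWord ++ b) b', o⟩
      (11 * u.word.length + 8 * w.word.length)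
      ⟨⟨some (.tag u.tag), some .sep, fun j => decide (u.slot j = w.slot j), v.tu, w.tag⟩,
        tapes (u.word ++ a) a' b (w.word.reverse ++ b'), o⟩ := by
  have h₁ : (Prog.load (fun v => { v with tv := getTag v.y }) : MProg T).Runs
      ⟨v, tapes (u.word ++ a) a' (w.slotsWord ++ b) b', o⟩ 1
      ⟨{ v with tv := w.tag }, tapes (u.word ++ a) a' (w.slotsWord ++ b) b', o⟩ :=
    (Prog.Runs.load _ _).congr (by simp [hv])
  have h₂ : (pushY .b' : MProg T).Runs
      ⟨{ v with tv := w.tag }, tapes (u.word ++ a) a' (w.slotsWord ++ b) b', o⟩ 1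
      ⟨{ v with tv := w.tag },
        tapes (u.word ++ a) a' (w.slotsWord ++ b) (.tag w.tag :: b'), o⟩ :=
    (runs_pushY _ _ _ _).congr (by simp [hv])
  have h₃ : (popX .a : MProg T).Runs
      ⟨{ v with tv := w.tag },
        tapes (u.word ++ a) a' (w.slotsWord ++ b) (.tag w.tag :: b'), o⟩ 1
      ⟨{ v with x := some (.tag u.tag), tv := w.tag },
        tapes (u.slotsWord ++ a) a' (w.slotsWord ++ b) (.tag w.tag :: b'), o⟩ :=
    (runs_popX _ _ _ _).congr (by simp [Item.word])
  have h₄ : (pushX .a' : MProg T).Runs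
      ⟨{ v with x := some (.tag u.tag), tv := w.tag },
        tapes (u.slotsWord ++ a) a' (w.slotsWord ++ b) (.tag w.tag :: b'), o⟩ 1
      ⟨{ v with x := some (.tag u.tag), tv := w.tag },
        tapes (Item.slotWord T (u.slot 2) ++
            (Item.slotWord T (u.slot 1) ++ (Item.slotWord T (u.slot 0) ++ a)))
          (.tag u.tag :: a')
          (Item.slotWord T (w.slot 2) ++
            (Item.slotWord T (w.slot 1) ++ (Item.slotWord T (w.slot 0) ++ b)))
          (.tag w.tag :: b'), o⟩ :=
    (runs_pushX _ _ _ _).congr (by simp [Item.slotsWord])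
  have h₅ := runs_rewindItem
    ⟨some .sep, some .sep, fun j => decide (u.slot j = w.slot j), v.tu, w.tag⟩ u.tag
    u.slotsWord.reverse (fun s hs => isTag_slotsWord (by simpa using hs)) a a' b
    (w.slotsWord.reverse ++ .tag w.tag :: b') o
  refine (h₁.seq <| h₂.seq <| h₃.seq <| h₄.seq <|
    (runs_compareSlot 2 (u.slot 2) (w.slot 2) _ _ _ _ _ _).seq <|
    (runs_compareSlot 1 (u.slot 1) (w.slot 1) _ _ _ _ _ _).seq <|
    ((runs_compareSlot 0 (u.slot 0) (w.slot 0) _ _ _ _ _ _).congr ?_).seq h₅).congr_weaken ?_ ?_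
  · simp only [Item.slotsWord, List.reverse_append, List.append_assoc, Mem.mk.injEq, and_true,
      State.mk.injEq, true_and]
    funext j
    fin_cases j <;> rfl
  · simp [Item.word]
  · have := u.length_word
    have := w.length_word
    simp only [Item.word, List.length_cons, List.length_reverse] at *
    omega

end MatrixProg

/-- The word of a list of items. -/
def itemsWord {T : Type} (I : List (Item T)) : List (ItemSymbol T) := I.flatMap Item.word

/-- The rows of the matrix of a list of vertices: a row begins with the mark of its vertex. -/
def matrixWord {V : Type} (adj : V → V → Bool) (cov : V → Bool) (l : List V) : List GraphSymbol :=
  l.flatMap fun u => GraphSymbol.row (cov u) :: l.map fun v => GraphSymbol.entry (adj u v)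

/-- The vertices that belong to a list of items: every item is paired with every component. -/
def itemVertices {T F : Type} (I : List (Item T)) (l : List F) : List (Item T × F) :=
  I.flatMap fun u => l.map fun c => (u, c)

/-- Vertices of items are compared through their tags, their components, and the slots in which
they agree. -/
def itemAdj {T F : Type} (adj : T × F → T × F → (Fin 3 → Bool) → Bool) (p q : Item T × F) : Bool :=
  adj (p.1.tag, p.2) (q.1.tag, q.2) fun j => decide (p.1.slot j = q.1.slot j)

/-! ### The loops over pairs of items. -/

namespace MatrixProg

variable {T F : Type} (l : List F)
  (adj : T × F → T × F → (Fin 3 → Bool) → Bool) (cov : T × F → Bool)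

/-- The reversed row of a vertex in the matrix. -/
def revRow (I : List (Item T)) (p : Item T × F) : List GraphSymbol :=
  .row (cov (p.1.tag, p.2)) :: ((itemVertices I l).map fun q => .entry (itemAdj adj p q)).reverse

theorem length_le_length_itemsWord (I : List (Item T)) : I.length ≤ (itemsWord I).length := by
  induction I with
  | nil => simp
  | cons u I ih =>
    have : (itemsWord (u :: I)).length = u.word.length + (itemsWord I).length := by
      simp [itemsWord]
    rw [this, List.length_cons, Item.length_word]
    omega

theorem length_word_le {I : List (Item T)} {u : Item T} (hu : u ∈ I) :
    u.word.length ≤ (itemsWord I).length := by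
  unfold itemsWord
  rw [List.length_flatMap]
  exact List.le_sum_of_mem (List.mem_map.2 ⟨u, hu, rfl⟩)

/-- Drop a slot of the first tape. -/
def dropSlot : MProg T :=
  .seq (.load fun v => { v with x := none }) (.loop (fun v => !isSep v.x) (popX .a))

theorem runs_dropSlot (n : ℕ) (v : State T) (a a' b b' : List (ItemSymbol T))
    (o : List GraphSymbol) :
    dropSlot.Runs ⟨v, tapes (Item.slotWord T n ++ a) a' b b', o⟩ (2 * n + 4)
      ⟨{ v with x := some .sep }, tapes a a' b b', o⟩ := by
  suffices h : ∀ v : State T, isSep v.x = false →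
      (Prog.loop (fun v => !isSep v.x) (popX .a) : MProg T).Runs
        ⟨v, tapes (Item.slotWord T n ++ a) a' b b', o⟩ (2 * n + 3)
        ⟨{ v with x := some .sep }, tapes a a' b b', o⟩ by
    exact ((Prog.Runs.load _ _).seq (h _ rfl)).congr_weaken rfl (by omega)
  induction n with
  | zero =>
    intro v hv
    refine (Prog.Runs.loop_step (by simp [hv]) (runs_popX _ _ _ _)
      (Prog.Runs.loop_exit ?_)).congr_weaken ?_ ?_
    · simp [Item.slotWord_zero]
    · simp [Item.slotWord_zero]
    · omega
  | succ n ih =>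
    intro v hv
    refine (Prog.Runs.loop_step (by simp [hv]) ((runs_popX _ _ _ _).congr (b' :=
      ⟨{ v with x := some .tick }, tapes (Item.slotWord T n ++ a) a' b b', o⟩) ?_)
      (ih _ ?_)).congr_weaken ?_ ?_
    · simp [Item.slotWord_succ]
    · rfl
    · simp
    · omega

/-- Copy the input to both tapes, in reverse. -/
def copyLoop : MProg T :=
  .loop (fun v => v.x.isSome) (.seq (pushX .a') (.seq (pushX .b') (popX .a)))

theorem runs_copyLoop (w : List (ItemSymbol T)) (v : State T) (hv : v.x = w.head?)
    (a' b' : List (ItemSymbol T)) (o : List GraphSymbol) :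
    copyLoop.Runs ⟨v, tapes w.tail a' [] b', o⟩ (4 * w.length + 1)
      ⟨{ v with x := none }, tapes [] (w.reverse ++ a') [] (w.reverse ++ b'), o⟩ := by
  induction w generalizing v a' b' with
  | nil =>
    refine (Prog.Runs.loop_exit (by simp [hv])).congr_weaken ?_ (by omega)
    simp only [List.head?_nil] at hv
    simp [← hv]
  | cons s w ih =>
    refine (Prog.Runs.loop_step (by simp [hv]) (((runs_pushX _ _ _ _).seq
      ((runs_pushX _ _ _ _).seq (runs_popX _ _ _ _))).congr (b' :=
      ⟨{ v with x := w.head? }, tapes w.tail (s :: a') [] (s :: b'), o⟩) ?_)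
      (ih _ rfl _ _)).congr_weaken ?_ ?_
    · simp [hv]
    · simp
    · simp only [List.length_cons]; omega

/-- The loop that empties the second tape. -/
def drainLoop : MProg T := .loop (fun v => v.x.isSome) (popX .b)

theorem runs_drainLoop (w : List (ItemSymbol T)) (v : State T) (hv : v.x = w.head?)
    (o : List GraphSymbol) :
    drainLoop.Runs ⟨v, tapes [] [] w.tail [], o⟩ (2 * w.length + 1)
      ⟨{ v with x := none }, tapes [] [] [] [], o⟩ := by
  induction w generalizing v with
  | nil =>
    refine (Prog.Runs.loop_exit (by simp [hv])).congr_weaken ?_ (by omega)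
    simp only [List.head?_nil] at hv
    simp [← hv]
  | cons s w ih =>
    refine (Prog.Runs.loop_step (by simp [hv]) ((runs_popX _ _ _ _).congr (b' :=
      ⟨{ v with x := w.head? }, tapes [] [] w.tail [], o⟩) ?_) (ih _ rfl)).congr_weaken ?_ ?_
    · simp
    · simp
    · simp only [List.length_cons]; omega

theorem single_eq_tapes (w : List (ItemSymbol T)) :
    Prog.single (Γ := fun _ => ItemSymbol T) Stack.a w = tapes w [] [] [] := by
  funext k
  cases k <;> rfl

theorem tapes_nil : (tapes [] [] [] [] : Stack → List (ItemSymbol T)) = fun _ => [] := by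
  funext k
  cases k <;> rfl

/-- Rows, and entries within a row, come out back to front, which amounts to reversing the list of
vertices; the mark of a row is emitted last and so stands first. -/
theorem flatten_map_revRow (I : List (Item T)) :
    ((itemVertices I l).map (revRow l adj cov I)).reverse.flatten =
      matrixWord (itemAdj adj) (fun p => cov (p.1.tag, p.2)) (itemVertices I l).reverse := by
  rw [← List.map_reverse, ← List.flatMap_def]
  simp only [matrixWord, List.map_reverse]
  rfl

/-- The entries for a pair of items. -/
def entries (c : F) : MProg T :=
  Prog.forList l fun d => .emit fun v => .entry (adj (v.tu, c) (v.tv, d) v.share)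

theorem runs_entries (c : F) (v : State T) (S : Stack → List (ItemSymbol T))
    (o : List GraphSymbol) :
    (entries l adj c).Runs ⟨v, S, o⟩ (l.length + 1)
      ⟨v, S, (l.map fun d => .entry (adj (v.tu, c) (v.tv, d) v.share)).reverse ++ o⟩ := by
  refine (Prog.Runs.forList (t := 1)
    (g := fun d => [.entry (adj (v.tu, c) (v.tv, d) v.share)])
    (fun d _ o => Prog.Runs.emit _ _) o).congr_weaken ?_ (by omega)
  rw [← List.map_reverse, ← List.map_reverse, ← List.flatMap_def, ← List.map_eq_flatMap]

variable [Inhabited T]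

/-- The state between two rows, where `t` is the tag of the current item. -/
def base (t : T) : State T := ⟨none, none, fun _ => false, t, default⟩

/-- The loop over the second tape for a row. -/
def entriesLoop (c : F) : MProg T :=
  .loop (fun v => v.y.isSome) (.seq compareItem (.seq (entries l adj c) (popY .b)))

/-- The final state depends on the last comparison; only its `tu` is needed, since the program for a
row resets everything else. -/
theorem runs_entriesLoop (c : F) (u : Item T) (I : List (Item T)) (v : State T) (hv : v.tu = u.tag)
    (hy : v.y = (itemsWord I).head?) (a a' b' : List (ItemSymbol T)) (o : List GraphSymbol) :
    ∃ v' : State T, v'.tu = u.tag ∧ (entriesLoop l adj c).Runs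
      ⟨v, tapes (u.word ++ a) a' (itemsWord I).tail b', o⟩
      (I.length * (11 * u.word.length + l.length + 3) + 8 * (itemsWord I).length + 1)
      ⟨v', tapes (u.word ++ a) a' [] ((itemsWord I).reverse ++ b'),
        ((itemVertices I l).map fun q => .entry (itemAdj adj (u, c) q)).reverse ++ o⟩ := by
  induction I generalizing v b' o with
  | nil =>
    refine ⟨v, hv, (Prog.Runs.loop_exit (by simp [hy, itemsWord])).congr_weaken ?_ (by omega)⟩
    simp [itemsWord, itemVertices]
  | cons w I ih =>
    have hw : itemsWord (w :: I) = .tag w.tag :: (w.slotsWord ++ itemsWord I) := rfl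
    obtain ⟨v', hv', h⟩ := ih
      ⟨some (.tag u.tag), (itemsWord I).head?, fun j => decide (u.slot j = w.slot j), v.tu, w.tag⟩
      hv rfl (w.word.reverse ++ b')
      ((l.map fun d => .entry (itemAdj adj (u, c) (w, d))).reverse ++ o)
    refine ⟨v', hv', ?_⟩
    refine (Prog.Runs.loop_step (by simp [hy, hw]) (((runs_compareItem u w v (by simp [hy, hw])
      a a' (itemsWord I) b' o).seq ((runs_entries l adj c _ _ _).seq
      (runs_popY _ _ _ _))).congr ?_) h).congr_weaken ?_ ?_
    · simp [hv, itemAdj]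
    · simp [itemVertices, itemsWord]
    · have : (itemsWord (w :: I)).length = w.word.length + (itemsWord I).length := by
        simp [itemsWord]
      rw [this, List.length_cons]
      linarith

/-- The program for a row. -/
def row (c : F) : MProg T :=
  .seq (popY .b) <|
  .seq (entriesLoop l adj c) <|
  .seq (.emit fun v => .row (cov (v.tu, c))) <|
  .seq (move .b' .b) <|
  .load fun v => base v.tu

/-- A bound on the time for a row. -/
def rowTime (f L : ℕ) : ℕ := L * (11 * L + f + 3) + 11 * L + 7

theorem runs_row (c : F) (u : Item T) (I : List (Item T))
    (hu : u.word.length ≤ (itemsWord I).length) (a a' : List (ItemSymbol T))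
    (o : List GraphSymbol) :
    (row l adj cov c).Runs ⟨base u.tag, tapes (u.word ++ a) a' (itemsWord I) [], o⟩
      (rowTime l.length (itemsWord I).length)
      ⟨base u.tag, tapes (u.word ++ a) a' (itemsWord I) [], revRow l adj cov I (u, c) ++ o⟩ := by
  obtain ⟨v, hv, h⟩ := runs_entriesLoop l adj c u I
    ⟨none, (itemsWord I).head?, fun _ => false, u.tag, default⟩ rfl rfl a a' [] o
  refine (((runs_popY _ _ _ _).congr (b' := ⟨⟨none, (itemsWord I).head?, fun _ => false, u.tag,
    default⟩, tapes (u.word ++ a) a' (itemsWord I).tail [], o⟩) ?_).seq (h.seq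
    ((Prog.Runs.emit _ _).seq ((runs_move (by decide) _ _ _).seq
    (Prog.Runs.load _ _))))).congr_weaken ?_ ?_
  · simp [base]
  · simp [hv, revRow]
  · have h₁ := length_le_length_itemsWord I
    have h₂ : I.length * (11 * u.word.length + l.length + 3) ≤
        (itemsWord I).length * (11 * (itemsWord I).length + l.length + 3) := by gcongr
    simp only [rowTime, tapes_b', List.append_nil, List.length_reverse]
    omega

/-- The loop over the rows. -/
def rowsLoop : MProg T :=
  .loop (fun v => v.x.isSome) <|
    .seq (.load fun v => { v with tu := getTag v.x }) <|
    .seq (pushX .a) <|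
    .seq (.load fun v => base v.tu) <|
    .seq (Prog.forList l (row l adj cov)) <|
    .seq (popX .a) <|
    .seq dropSlot <|
    .seq dropSlot <|
    .seq dropSlot <|
    .seq (.load fun _ => base default) <|
    popX .a

/-- `J` is the part of the list still on the first tape. The second tape carries all of `I` and is
restored after every row. -/
theorem runs_rowsLoop (I J : List (Item T)) (hJ : ∀ u ∈ J, u ∈ I) (o : List GraphSymbol) :
    (rowsLoop l adj cov).Runs
      ⟨{ base default with x := (itemsWord J).head? }, tapes (itemsWord J).tail [] (itemsWord I) [],
        o⟩
      (J.length * (l.length * rowTime l.length (itemsWord I).length + 19) +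
        2 * (itemsWord J).length + 1)
      ⟨base default, tapes [] [] (itemsWord I) [],
        ((itemVertices J l).map (revRow l adj cov I)).reverse.flatten ++ o⟩ := by
  induction J generalizing o with
  | nil =>
    refine (Prog.Runs.loop_exit (by simp [itemsWord])).congr_weaken ?_ (by omega)
    simp [itemsWord, itemVertices, base]
  | cons u J ih =>
    have hu := length_word_le (hJ u (by simp))
    have hw : itemsWord (u :: J) = .tag u.tag :: (u.slotsWord ++ itemsWord J) := rfl
    have h₁ : (Prog.load (fun v => { v with tu := getTag v.x }) : MProg T).Runs
        ⟨{ base default with x := (itemsWord (u :: J)).head? },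
          tapes (itemsWord (u :: J)).tail [] (itemsWord I) [], o⟩ 1
        ⟨{ base u.tag with x := some (.tag u.tag) },
          tapes (u.slotsWord ++ itemsWord J) [] (itemsWord I) [], o⟩ :=
      (Prog.Runs.load _ _).congr (by simp [hw, base])
    have h₂ : (pushX .a : MProg T).Runs
        ⟨{ base u.tag with x := some (.tag u.tag) },
          tapes (u.slotsWord ++ itemsWord J) [] (itemsWord I) [], o⟩ 1
        ⟨{ base u.tag with x := some (.tag u.tag) },
          tapes (u.word ++ itemsWord J) [] (itemsWord I) [], o⟩ :=
      (runs_pushX _ _ _ _).congr (by simp [Item.word])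
    have h₃ : (Prog.load (fun v => base v.tu) : MProg T).Runs
        ⟨{ base u.tag with x := some (.tag u.tag) },
          tapes (u.word ++ itemsWord J) [] (itemsWord I) [], o⟩ 1
        ⟨base u.tag, tapes (u.word ++ itemsWord J) [] (itemsWord I) [], o⟩ :=
      Prog.Runs.load _ _
    have h₄ := Prog.Runs.forList (l := l) (g := fun c => revRow l adj cov I (u, c))
      (fun c _ o => runs_row l adj cov c u I hu (itemsWord J) [] o) o
    set o' := (l.map fun c => revRow l adj cov I (u, c)).reverse.flatten ++ o with ho'
    have h₅ : (popX .a : MProg T).Runs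
        ⟨base u.tag, tapes (u.word ++ itemsWord J) [] (itemsWord I) [], o'⟩ 1
        ⟨{ base u.tag with x := some (.tag u.tag) },
          tapes (Item.slotWord T (u.slot 2) ++ (Item.slotWord T (u.slot 1) ++
            (Item.slotWord T (u.slot 0) ++ itemsWord J))) [] (itemsWord I) [], o'⟩ :=
      (runs_popX _ _ _ _).congr (by simp [Item.word, Item.slotsWord])
    refine (Prog.Runs.loop_step (by simp [hw]) ((h₁.seq <| h₂.seq <| h₃.seq <| h₄.seq <| h₅.seq <|
      (runs_dropSlot _ _ _ _ _ _ _).seq <| (runs_dropSlot _ _ _ _ _ _ _).seq <|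
      (runs_dropSlot _ _ _ _ _ _ _).seq <| (Prog.Runs.load _ _).seq (runs_popX _ _ _ _)).congr ?_)
      (ih (fun w hw => hJ w (by simp [hw])) o')).congr_weaken ?_ ?_
    · simp
    · simp [itemVertices, ho', Function.comp_def]
    · have : (itemsWord (u :: J)).length = u.word.length + (itemsWord J).length := by
        simp [itemsWord]
      rw [this, List.length_cons, Item.length_word, add_mul, one_mul]
      omega

/-- The program that writes the matrix of a list of items. -/
def matrixProg : MProg T :=
  .seq (popX .a) <|
  .seq copyLoop <|
  .seq (move .a' .a) <|
  .seq (move .b' .b) <|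
  .seq (popX .a) <|
  .seq (rowsLoop l adj cov) <|
  .seq (popX .b) <|
  drainLoop

theorem runs_matrixProg (I : List (Item T)) :
    (matrixProg l adj cov).Runs
      ⟨base default, Prog.single Stack.a (itemsWord I), []⟩
      (200 * (l.length + 1) ^ 2 * ((itemsWord I).length + 1) ^ 3)
      ⟨base default, fun _ => [],
        matrixWord (itemAdj adj) (fun p => cov (p.1.tag, p.2)) (itemVertices I l).reverse⟩ := by
  rw [single_eq_tapes, ← tapes_nil, ← flatten_map_revRow]
  set w := itemsWord I with hw
  refine (((runs_popX _ _ _ _).congr (b' :=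
      ⟨{ base default with x := w.head? }, tapes w.tail [] [] [], []⟩) ?_).seq <|
    (runs_copyLoop w _ rfl [] [] []).seq <|
    (runs_move (by decide) _ _ _).seq <|
    (runs_move (by decide) _ _ _).seq <|
    ((runs_popX _ _ _ _).congr (b' :=
      ⟨{ base default with x := w.head? }, tapes w.tail [] w [], []⟩) ?_).seq <|
    (runs_rowsLoop l adj cov I I (fun _ h => h) []).seq <|
    ((runs_popX _ _ _ _).congr (b' :=
      ⟨{ base default with x := w.head? }, tapes [] [] w.tail [],
        ((itemVertices I l).map (revRow l adj cov I)).reverse.flatten⟩) ?_).seq <|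
    runs_drainLoop w _ rfl _).congr_weaken ?_ ?_
  · simp
  · simp [base]
  · simp [hw]
  · simp [base]
  · have h := length_le_length_itemsWord I
    rw [← hw] at h ⊢
    simp only [tapes_a', tapes_b', List.append_nil, List.length_reverse, update_tapes_a,
      update_tapes_a']
    -- There are at most `w.length` items, each with `l.length` rows of quadratic cost, so the total
    -- is cubic; copying, moving and draining are linear.
    have h₁ : I.length * (l.length * rowTime l.length w.length + 19) ≤
        w.length * (l.length * rowTime l.length w.length + 19) := by gcongr
    refine le_trans (b := w.length * (l.length * rowTime l.length w.length + 19) +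
      18 * w.length + 20) (by omega) ?_
    generalize w.length = L
    generalize l.length = f
    unfold rowTime
    nlinarith [Nat.zero_le (L^2), Nat.zero_le (f * L), Nat.zero_le (f*L^2), Nat.zero_le (f^2*L^2),
      Nat.zero_le (f^2*L^3), Nat.zero_le (f*L^3), Nat.zero_le (L^3), Nat.zero_le (f^2*L),
      Nat.zero_le (f^2)]

end MatrixProg

/-! ### The items of a formula -/

/-- At most three literals, each with the position of its variable inside its block. -/
abbrev ShortClause (s : ℕ) : Type := {L : List (Fin s × Bool) // L.length ≤ 3}

/-- The residue of a number modulo `s`. -/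
def residue (s : ℕ) [NeZero s] (n : ℕ) : Fin s := ⟨n % s, Nat.mod_lt n (NeZero.pos s)⟩

@[simp] theorem residue_val (s : ℕ) [NeZero s] (n : ℕ) : (residue s n).val = n % s := rfl

@[simp] theorem residue_mod_add (s : ℕ) [NeZero s] (n k : ℕ) :
    residue s (n % s + k) = residue s (n + k) := by
  ext; simp

instance (s : ℕ) : Finite (ShortClause s) := (List.finite_length_le (Fin s × Bool) 3).to_subtype

/-- The tags of the items: the palette, a block of `s` variables, and a clause, of which the literals
are listed in reverse. -/
inductive VertexTag (s : ℕ) where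
  | palette : VertexTag s
  | block : VertexTag s
  | clause : ShortClause s → VertexTag s

instance (s : ℕ) : Inhabited (VertexTag s) := ⟨.palette⟩

instance (s : ℕ) : Finite (VertexTag s) := by
  refine Finite.of_injective (β := Option (Option (ShortClause s))) (fun t => match t with
    | .palette => none
    | .block => some none
    | .clause L => some (some L)) ?_
  intro t u h
  cases t <;> cases u <;> simp_all

namespace ThreeCNF

variable (s : ℕ)

/-- The item of the palette. -/
def paletteItem : Item (VertexTag s) := ⟨.palette, fun _ => 0⟩

/-- The item of a block. -/
def blockItem (b : ℕ) : Item (VertexTag s) := ⟨.block, fun _ => b⟩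

/-- The number of blocks of `s` variables that cover `n` variables. -/
def numBlocks (n : ℕ) : ℕ := (n + s - 1) / s

theorem numBlocks_zero [NeZero s] : numBlocks s 0 = 0 := by
  have := NeZero.pos s
  exact Nat.div_eq_of_lt (by omega)

/-- This recursion mirrors the program, which opens a block whenever the number of variables seen so
far is divisible by `s`. -/
theorem numBlocks_succ [NeZero s] (n : ℕ) :
    numBlocks s (n + 1) = numBlocks s n + if s ∣ n then 1 else 0 := by
  have := NeZero.pos s
  unfold numBlocks
  rw [show n + 1 + s - 1 = (n + s - 1) + 1 by omega, Nat.succ_div,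
    show n + s - 1 + 1 = n + s by omega]
  simp

variable [NeZero s]

/-- The literals of a clause, in reverse. -/
def shortClause {n : ℕ} (C : List (Fin n × Bool)) (hC : C.length ≤ 3) : ShortClause s :=
  ⟨(C.map fun l => (residue s l.1.val, l.2)).reverse, by simpa using hC⟩

/-- The item of a clause: the slots hold the blocks of the variables. -/
def clauseItem {n : ℕ} (C : {C : List (Fin n × Bool) // C.length ≤ 3}) : Item (VertexTag s) :=
  ⟨.clause (shortClause s C.1 C.2), fun j => ((C.1[j.val]?).map fun l => l.1.val / s).getD 0⟩

/-- The items of a formula. -/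
def items (φ : ThreeCNF) : List (Item (VertexTag s)) :=
  (φ.clauses.attachWith (fun C => C.length ≤ 3) φ.length_le).reverse.map (clauseItem s) ++
    ((List.range (numBlocks s φ.numVars)).reverse.map (blockItem s) ++ [paletteItem s])

end ThreeCNF

/-! ### The program that computes the items of a formula -/

namespace Prog

variable {K : Type} {Γ : K → Type} {β σ : Type}

/-- The program that writes a word. -/
def emitWord (w : List β) : Prog K Γ β σ := forList w.reverse fun a => .emit fun _ => a

theorem runs_emitWord [DecidableEq K] (w : List β) (v : σ) (S : ∀ k, List (Γ k)) (o : List β) :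
    (emitWord w).Runs ⟨v, S, o⟩ (w.length + 1) ⟨v, S, w ++ o⟩ := by
  refine (Prog.Runs.forList (t := 1) (g := fun a => [a])
    (fun d _ o => Prog.Runs.emit _ _) o).congr_weaken ?_ (by simp)
  rw [← List.map_reverse, ← List.flatMap_def]
  simp

end Prog

namespace ItemsProg

variable {s : ℕ} [NeZero s]

/-- The literals read so far with one more literal. -/
def addLiteral (l : Fin s × Bool) (L : ShortClause s) : ShortClause s :=
  if h : L.1.length < 3 then ⟨l :: L.1, h⟩ else L

/-- The literals read so far when the index of the last variable is incremented. -/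
def bump (L : ShortClause s) : ShortClause s :=
  ⟨match L.1 with
    | [] => []
    | l :: L => (residue s (l.1.val + 1), l.2) :: L, by
    rcases L with ⟨_ | ⟨l, L⟩, h⟩
    · simp
    · simpa using h⟩

/-- The letters written when the index of the last variable is incremented. -/
def bumpWord (L : ShortClause s) : List (ItemSymbol (VertexTag s)) :=
  match L.1 with
  | [] => []
  | l :: _ => if s ∣ l.1.val + 1 then [.tick] else []

/-- The letters written at the end of a clause. -/
def finishWord (L : ShortClause s) : List (ItemSymbol (VertexTag s)) :=
  .tag (.clause L) :: List.replicate (3 - L.1.length) .sep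

/-- What is kept while a formula is read: the number of variables seen, modulo `s`, the literals of
the current clause, the number of blocks, and the output. -/
structure Conf (s : ℕ) where
  ctr : Fin s
  cl : Option (ShortClause s)
  blocks : ℕ
  out : List (ItemSymbol (VertexTag s))

/-- The output after the current clause is finished. -/
def Conf.close (c : Conf s) : List (ItemSymbol (VertexTag s)) :=
  match c.cl with
  | none => c.out
  | some L => finishWord L ++ c.out

/-- The effect of a letter. -/
def Conf.step (c : Conf s) : CNFSymbol → Conf s
  | .tick => match c.cl with
    | none =>
      if c.ctr.val = 0 then
        ⟨residue s (c.ctr.val + 1), none, c.blocks + 1,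
          (ThreeCNF.blockItem s c.blocks).word ++ c.out⟩
      else ⟨residue s (c.ctr.val + 1), none, c.blocks, c.out⟩
    | some L => ⟨c.ctr, some (bump L), c.blocks, bumpWord L ++ c.out⟩
  | .clause => ⟨c.ctr, some ⟨[], by simp⟩, c.blocks, c.close⟩
  | .lit b => match c.cl with
    | none => c
    | some L => ⟨c.ctr, some (addLiteral (residue s 0, b) L), c.blocks, .sep :: c.out⟩

/-- A block is written at its first variable, so an incomplete last block is included. The counter
modulo `s` suffices to detect this moment. -/
theorem foldl_step_ticks (n : ℕ) (o : List (ItemSymbol (VertexTag s))) :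
    (List.replicate n CNFSymbol.tick).foldl Conf.step ⟨residue s 0, none, 0, o⟩ =
      ⟨residue s n, none, ThreeCNF.numBlocks s n,
        itemsWord ((List.range (ThreeCNF.numBlocks s n)).reverse.map (ThreeCNF.blockItem s)) ++ o⟩ := by
  induction n with
  | zero => simp [ThreeCNF.numBlocks_zero, itemsWord]
  | succ n ih =>
    rw [List.replicate_succ', List.foldl_append, ih, ThreeCNF.numBlocks_succ]
    by_cases hn : s ∣ n
    · have hn' := Nat.mod_eq_zero_of_dvd hn
      have h := residue_mod_add s n 1
      rw [hn', zero_add] at h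
      simp [Conf.step, hn, hn', h, List.range_succ, itemsWord]
    · have hn' : n % s ≠ 0 := fun h => hn (Nat.dvd_of_mod_eq_zero h)
      simp [Conf.step, hn, hn']

/-- Division by `s` on the fly: the residue of the index is kept in the finite state, and a tick is
written each time it wraps around, which leaves the quotient in unary on top of the separator. -/
theorem foldl_step_literal {n : ℕ} (l : Fin n × Bool) (ctr : Fin s) (L : ShortClause s)
    (hL : L.1.length < 3) (k : ℕ) (o : List (ItemSymbol (VertexTag s))) :
    (encodeLiteral l).foldl Conf.step ⟨ctr, some L, k, o⟩ =
      ⟨ctr, some ⟨(residue s l.1.val, l.2) :: L.1, hL⟩, k,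
        Item.slotWord (VertexTag s) (l.1.val / s) ++ o⟩ := by
  suffices h : ∀ i : ℕ, (List.replicate i CNFSymbol.tick).foldl Conf.step
      ⟨ctr, some ⟨(residue s 0, l.2) :: L.1, hL⟩, k, .sep :: o⟩ =
      ⟨ctr, some ⟨(residue s i, l.2) :: L.1, hL⟩, k,
        Item.slotWord (VertexTag s) (i / s) ++ o⟩ by
    rw [encodeLiteral, List.foldl_cons]
    simp only [Conf.step, addLiteral, hL, dite_true]
    exact h _
  intro i
  induction i with
  | zero => simp [Item.slotWord_zero]
  | succ i ih =>
    rw [List.replicate_succ', List.foldl_append, ih, Nat.succ_div]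
    have h' : s ∣ i % s + 1 ↔ s ∣ i + 1 := by
      rw [Nat.dvd_iff_mod_eq_zero, Nat.dvd_iff_mod_eq_zero, Nat.mod_add_mod]
    by_cases hi : s ∣ i + 1
    · simp [Conf.step, bump, bumpWord, h', hi, Item.slotWord_succ]
    · simp [Conf.step, bump, bumpWord, h', hi]

theorem foldl_step_literals {n : ℕ} (C : List (Fin n × Bool)) (ctr : Fin s) (L : ShortClause s)
    (hL : L.1.length + C.length ≤ 3) (k : ℕ) (o : List (ItemSymbol (VertexTag s))) :
    (C.flatMap encodeLiteral).foldl Conf.step ⟨ctr, some L, k, o⟩ =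
      ⟨ctr, some ⟨(C.map fun l => (residue s l.1.val, l.2)).reverse ++ L.1, by
          simp; omega⟩, k,
        (C.reverse.flatMap fun l => Item.slotWord (VertexTag s) (l.1.val / s)) ++ o⟩ := by
  induction C generalizing L o with
  | nil => simp
  | cons l C ih =>
    rw [List.length_cons] at hL
    rw [List.flatMap_cons, List.foldl_append, foldl_step_literal l ctr L (by omega),
      ih _ (by simp; omega)]
    simp

/-- The slot of the first literal is written first and ends up last, which is why slots are listed
from 2 down to 0. Missing literals have the highest indices, so their empty slots come right after
the tag, where `finishWord` puts them. -/
theorem word_clauseItem {n : ℕ} (C : {C : List (Fin n × Bool) // C.length ≤ 3}) :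
    (ThreeCNF.clauseItem s C).word = finishWord (ThreeCNF.shortClause s C.1 C.2) ++
      C.1.reverse.flatMap fun l => Item.slotWord (VertexTag s) (l.1.val / s) := by
  obtain ⟨C, hC⟩ := C
  match C, hC with
  | [], _ => rfl
  | [l], _ => simp [ThreeCNF.clauseItem, Item.word, Item.slotsWord, finishWord,
      ThreeCNF.shortClause, Item.slotWord_zero, List.replicate_succ]
  | [l, l'], _ => simp [ThreeCNF.clauseItem, Item.word, Item.slotsWord, finishWord,
      ThreeCNF.shortClause, Item.slotWord_zero, List.replicate_succ]
  | [l, l', l''], _ => simp [ThreeCNF.clauseItem, Item.word, Item.slotsWord, finishWord,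
      ThreeCNF.shortClause]
  | _ :: _ :: _ :: _ :: _, hC => simp at hC; omega

/-- A clause gets its tag only when the next clause begins or the input ends, so the invariant
concerns the closed output. -/
theorem close_foldl_step_clauses {n : ℕ} (F : List (List (Fin n × Bool)))
    (hF : ∀ C ∈ F, C.length ≤ 3) (c : Conf s) :
    ((F.flatMap encodeClause).foldl Conf.step c).close =
      itemsWord ((F.attachWith (fun C => C.length ≤ 3) hF).reverse.map (ThreeCNF.clauseItem s)) ++
        c.close := by
  induction F generalizing c with
  | nil => simp [itemsWord]
  | cons C F ih =>
    have hC := hF C (by simp)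
    rw [List.flatMap_cons, List.foldl_append, ih fun D hD => hF D (by simp [hD])]
    have h : ((encodeClause C).foldl Conf.step c).close =
        (ThreeCNF.clauseItem s ⟨C, hC⟩).word ++ c.close := by
      rw [word_clauseItem, encodeClause, List.foldl_cons]
      simp only [Conf.step]
      rw [foldl_step_literals C _ _ (by simpa using hC)]
      simp [Conf.close, ThreeCNF.shortClause]
    rw [h]
    simp [itemsWord]

theorem close_foldl_step (φ : ThreeCNF) :
    (φ.encode.foldl Conf.step ⟨residue s 0, none, 0, (ThreeCNF.paletteItem s).word⟩).close =
      itemsWord (φ.items s) := by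
  rw [ThreeCNF.encode, List.foldl_append, foldl_step_ticks, close_foldl_step_clauses φ.clauses
    φ.length_le]
  simp [Conf.close, ThreeCNF.items, itemsWord]

/-- Each letter opens at most one block. This bounds the unary counter and with it the cost of
writing block items. -/
theorem blocks_foldl_step_le (w : List CNFSymbol) (c : Conf s) :
    (w.foldl Conf.step c).blocks ≤ c.blocks + w.length := by
  induction w generalizing c with
  | nil => simp
  | cons a w ih =>
    refine (ih _).trans ?_
    have : (c.step a).blocks ≤ c.blocks + 1 := by
      unfold Conf.step
      split
      · split
        · split <;> simp
        · simp
      · simp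
      · split <;> simp
    rw [List.length_cons]
    omega

end ItemsProg

instance : Finite CNFSymbol := by
  refine Finite.of_injective (β := Option (Option Bool)) (fun a => match a with
    | .tick => none
    | .clause => some none
    | .lit b => some (some b)) ?_
  intro a b h
  cases a <;> cases b <;> simp_all

noncomputable instance : Fintype CNFSymbol := Fintype.ofFinite _

/-! ### The stack program that carries out the letter-by-letter transitions. -/

namespace ItemsProg

variable {s : ℕ}

/-- The stacks of the program: the input, and a counter that is split in two. -/
inductive Stack where
  | inp | n | n'
  deriving DecidableEq

instance : Fintype Stack := ⟨{.inp, .n, .n'}, fun k => by cases k <;> simp⟩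

/-- The alphabets of the stacks. -/
abbrev Alphabet : Stack → Type
  | .inp => CNFSymbol
  | .n => Unit
  | .n' => Unit

noncomputable instance : Fintype (Alphabet .inp) := inferInstanceAs (Fintype CNFSymbol)

/-- The finite state of the program: the letter read last, whether the counter was positive, the
number of variables seen, modulo `s`, and the literals of the current clause. -/
structure State (s : ℕ) where
  x : Option CNFSymbol
  u : Bool
  ctr : Fin s
  cl : Option (ShortClause s)

instance : Finite (State s) := by
  refine Finite.of_injective
    (β := Option CNFSymbol × Bool × Fin s × Option (ShortClause s))
    (fun v => (v.x, v.u, v.ctr, v.cl)) ?_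
  rintro ⟨⟩ ⟨⟩ h
  simp_all

/-- The stacks with the given contents. -/
def tapes (w : List CNFSymbol) (k k' : ℕ) : ∀ j, List (Alphabet j)
  | .inp => w
  | .n => List.replicate k ()
  | .n' => List.replicate k' ()

/-- Programs on these stacks. -/
abbrev IProg (s : ℕ) := Prog Stack Alphabet (ItemSymbol (VertexTag s)) (State s)

/-- Read a letter of the input. -/
def popInp : IProg s := .pop .inp fun v x => { v with x := x }

/-- Decrement the first part of the counter. -/
def popN : IProg s := .pop .n fun v x => { v with u := x.isSome }

/-- Decrement the second part of the counter. -/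
def popN' : IProg s := .pop .n' fun v x => { v with u := x.isSome }

/-- Increment the first part of the counter. -/
def pushN : IProg s := .push .n fun _ => ()

/-- Increment the second part of the counter. -/
def pushN' : IProg s := .push .n' fun _ => ()

section basic

variable (v : State s) (w : List CNFSymbol) (k k' : ℕ) (o : List (ItemSymbol (VertexTag s)))

theorem runs_popInp : popInp.Runs ⟨v, tapes w k k', o⟩ 1
    ⟨{ v with x := w.head? }, tapes w.tail k k', o⟩ := by
  refine (Prog.Runs.pop _ _ _).congr ?_
  simp only [Mem.mk.injEq, and_true]
  refine ⟨rfl, ?_⟩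
  funext j
  cases j <;> rfl

theorem isSome_head?_replicate (k : ℕ) :
    (List.replicate k ()).head?.isSome = decide (0 < k) := by
  cases k <;> simp [List.replicate_succ]

theorem runs_popN : popN.Runs ⟨v, tapes w k k', o⟩ 1
    ⟨{ v with u := decide (0 < k) }, tapes w (k - 1) k', o⟩ := by
  refine (Prog.Runs.pop _ _ _).congr ?_
  simp only [Mem.mk.injEq, and_true]
  refine ⟨by simp [tapes, isSome_head?_replicate], ?_⟩
  funext j
  cases j <;> simp [tapes]

theorem runs_popN' : popN'.Runs ⟨v, tapes w k k', o⟩ 1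
    ⟨{ v with u := decide (0 < k') }, tapes w k (k' - 1), o⟩ := by
  refine (Prog.Runs.pop _ _ _).congr ?_
  simp only [Mem.mk.injEq, and_true]
  refine ⟨by simp [tapes, isSome_head?_replicate], ?_⟩
  funext j
  cases j <;> simp [tapes]

theorem runs_pushN : pushN.Runs ⟨v, tapes w k k', o⟩ 1 ⟨v, tapes w (k + 1) k', o⟩ := by
  refine (Prog.Runs.push _ _ _).congr ?_
  simp only [Mem.mk.injEq, and_true, true_and]
  funext j
  cases j <;> simp [tapes, List.replicate_succ]

theorem runs_pushN' : pushN'.Runs ⟨v, tapes w k k', o⟩ 1 ⟨v, tapes w k (k' + 1), o⟩ := by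
  refine (Prog.Runs.push _ _ _).congr ?_
  simp only [Mem.mk.injEq, and_true, true_and]
  funext j
  cases j <;> simp [tapes, List.replicate_succ]

end basic

/-- Write the counter in unary. -/
def writeLoop : IProg s := .loop (fun v => v.u) (.seq pushN' (.seq (.emit fun _ => .tick) popN))

/-- Restore the counter. -/
def restoreLoop : IProg s := .loop (fun v => v.u) (.seq pushN popN')

/-- Empty the counter. -/
def drainLoop : IProg s := .loop (fun v => v.u) popN

/-- The flag `u` tells whether the preceding pop found a letter, so the stack holds `k - 1` letters
while `k` ticks are still to be written. The letters are saved on the other stack for the restoring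
loop. -/
theorem runs_writeLoop (k : ℕ) (v : State s) (hv : v.u = decide (0 < k)) (w : List CNFSymbol)
    (k' : ℕ) (o : List (ItemSymbol (VertexTag s))) :
    writeLoop.Runs ⟨v, tapes w (k - 1) k', o⟩ (4 * k + 1)
      ⟨{ v with u := false }, tapes w 0 (k' + k), List.replicate k .tick ++ o⟩ := by
  induction k generalizing v k' o with
  | zero =>
    refine (Prog.Runs.loop_exit (by simp [hv])).congr_weaken ?_ (by omega)
    simp only [lt_self_iff_false, decide_false] at hv
    simp [← hv]
  | succ k ih =>
    refine (Prog.Runs.loop_step (by simp [hv]) ((runs_pushN' _ _ _ _ _).seq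
      ((Prog.Runs.emit _ _).seq (runs_popN _ _ _ _ _))) (ih _ rfl _ _)).congr_weaken ?_ (by omega)
    simp only [Mem.mk.injEq, true_and]
    exact ⟨by congr 1; omega, by simp [List.replicate_succ']⟩

theorem runs_restoreLoop (k' : ℕ) (v : State s) (hv : v.u = decide (0 < k')) (w : List CNFSymbol)
    (k : ℕ) (o : List (ItemSymbol (VertexTag s))) :
    restoreLoop.Runs ⟨v, tapes w k (k' - 1), o⟩ (3 * k' + 1)
      ⟨{ v with u := false }, tapes w (k + k') 0, o⟩ := by
  induction k' generalizing v k with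
  | zero =>
    refine (Prog.Runs.loop_exit (by simp [hv])).congr_weaken ?_ (by omega)
    simp only [lt_self_iff_false, decide_false] at hv
    simp [← hv]
  | succ k' ih =>
    refine (Prog.Runs.loop_step (by simp [hv]) ((runs_pushN _ _ _ _ _).seq
      (runs_popN' _ _ _ _ _)) (ih _ rfl _)).congr_weaken ?_ (by omega)
    simp only [Mem.mk.injEq, true_and, and_true]
    congr 1; omega

theorem runs_drainLoop (k : ℕ) (v : State s) (hv : v.u = decide (0 < k)) (w : List CNFSymbol)
    (k' : ℕ) (o : List (ItemSymbol (VertexTag s))) :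
    drainLoop.Runs ⟨v, tapes w (k - 1) k', o⟩ (2 * k + 1)
      ⟨{ v with u := false }, tapes w 0 k', o⟩ := by
  induction k generalizing v with
  | zero =>
    refine (Prog.Runs.loop_exit (by simp [hv])).congr_weaken ?_ (by omega)
    simp only [lt_self_iff_false, decide_false] at hv
    simp [← hv]
  | succ k ih =>
    exact (Prog.Runs.loop_step (by simp [hv]) (runs_popN _ _ _ _ _) (ih _ rfl)).congr_weaken rfl
      (by omega)

/-- Write a slot with the value of the counter. -/
def writeSlot : IProg s :=
  .seq (.emit fun _ => .sep) <| .seq popN <| .seq writeLoop <| .seq popN' restoreLoop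

theorem runs_writeSlot (v : State s) (hv : v.u = false) (w : List CNFSymbol) (k : ℕ)
    (o : List (ItemSymbol (VertexTag s))) :
    writeSlot.Runs ⟨v, tapes w k 0, o⟩ (7 * k + 5)
      ⟨v, tapes w k 0, Item.slotWord (VertexTag s) k ++ o⟩ := by
  refine ((Prog.Runs.emit _ _).seq <| (runs_popN _ _ _ _ _).seq <|
    (runs_writeLoop k _ rfl _ _ _).seq <| (runs_popN' _ _ _ _ _).seq <|
    runs_restoreLoop _ _ (by simp) _ _ _).congr_weaken ?_ (by omega)
  simp [Item.slotWord, ← hv]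

/-- Write the item of a block. -/
def writeBlock : IProg s :=
  .seq writeSlot <| .seq writeSlot <| .seq writeSlot <| .emit fun _ => .tag .block

theorem runs_writeBlock (v : State s) (hv : v.u = false) (w : List CNFSymbol) (k : ℕ)
    (o : List (ItemSymbol (VertexTag s))) :
    writeBlock.Runs ⟨v, tapes w k 0, o⟩ (21 * k + 16)
      ⟨v, tapes w k 0, (ThreeCNF.blockItem s k).word ++ o⟩ := by
  refine ((runs_writeSlot v hv w k _).seq <| (runs_writeSlot v hv w k _).seq <|
    (runs_writeSlot v hv w k _).seq <| Prog.Runs.emit _ _).congr_weaken ?_ (by omega)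
  simp [Item.word, Item.slotsWord, ThreeCNF.blockItem]

theorem length_bumpWord_le (L : ShortClause s) : (bumpWord L).length ≤ 1 := by
  unfold bumpWord
  split
  · simp
  · split <;> simp

theorem length_finishWord_le (L : ShortClause s) : (finishWord L).length ≤ 4 := by
  simp [finishWord]
  omega

variable [NeZero s]

/-- The program that handles the letter read last. -/
def handle : IProg s := .switch fun v => match v.x, v.cl with
  | some .tick, none =>
    if v.ctr.val = 0 then
      .seq writeBlock (.seq pushN (.load fun v => { v with ctr := residue s (v.ctr.val + 1) }))
    else .load fun v => { v with ctr := residue s (v.ctr.val + 1) }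
  | some .tick, some L =>
    .seq (.emitWord (bumpWord L)) (.load fun v => { v with cl := some (bump L) })
  | some .clause, none => .load fun v => { v with cl := some ⟨[], by simp⟩ }
  | some .clause, some L =>
    .seq (.emitWord (finishWord L)) (.load fun v => { v with cl := some ⟨[], by simp⟩ })
  | some (.lit b), some L =>
    .seq (.emit fun _ => .sep) (.load fun v => { v with cl := some (addLiteral (residue s 0, b) L) })
  | _, _ => .load id

/-- The costliest letter is a tick that opens a block: three slots of `7 * k + 5` steps each and a
tag, with `k` the counter. -/
theorem runs_handle (c : Conf s) (a : CNFSymbol) (w : List CNFSymbol) :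
    handle.Runs ⟨⟨some a, false, c.ctr, c.cl⟩, tapes w c.blocks 0, c.out⟩ (21 * c.blocks + 20)
      ⟨⟨some a, false, (c.step a).ctr, (c.step a).cl⟩, tapes w (c.step a).blocks 0,
        (c.step a).out⟩ := by
  refine (Prog.Runs.switch (t := 21 * c.blocks + 19) ?_).weaken (by omega)
  rcases c with ⟨ctr, _ | L, k, o⟩
  · cases a with
    | tick =>
      by_cases h : ctr.val = 0
      · simp only [Conf.step, h, if_true]
        refine ((runs_writeBlock _ rfl _ _ _).seq
          ((runs_pushN _ _ _ _ _).seq (Prog.Runs.load _ _))).congr_weaken ?_ (by omega)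
        simp [h]
      · simp only [Conf.step, h, if_false]
        exact (Prog.Runs.load _ _).weaken (by omega)
    | clause => exact (Prog.Runs.load _ _).weaken (by omega)
    | lit b => exact (Prog.Runs.load _ _).weaken (by omega)
  · cases a with
    | tick =>
      have := length_bumpWord_le L
      exact ((Prog.runs_emitWord _ _ _ _).seq (Prog.Runs.load _ _)).weaken (by omega)
    | clause =>
      have := length_finishWord_le L
      exact ((Prog.runs_emitWord _ _ _ _).seq (Prog.Runs.load _ _)).weaken (by omega)
    | lit b => exact ((Prog.Runs.emit _ _).seq (Prog.Runs.load _ _)).weaken (by omega)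

/-- The loop over the input. -/
def mainLoop : IProg s := .loop (fun v => v.x.isSome) (.seq handle popInp)

theorem runs_mainLoop (w : List CNFSymbol) (c : Conf s) :
    mainLoop.Runs ⟨⟨w.head?, false, c.ctr, c.cl⟩, tapes w.tail c.blocks 0, c.out⟩
      (w.length * (21 * (c.blocks + w.length) + 22) + 1)
      ⟨⟨none, false, (w.foldl Conf.step c).ctr, (w.foldl Conf.step c).cl⟩,
        tapes [] (w.foldl Conf.step c).blocks 0, (w.foldl Conf.step c).out⟩ := by
  induction w generalizing c with
  | nil => exact (Prog.Runs.loop_exit rfl).weaken (by omega)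
  | cons a w ih =>
    refine (Prog.Runs.loop_step rfl ((runs_handle c a w).seq (runs_popInp _ _ _ _ _))
      (ih _)).congr_weaken rfl ?_
    have h : (c.step a).blocks ≤ c.blocks + 1 := by
      simpa using blocks_foldl_step_le [a] c
    have h' : w.length * (21 * ((c.step a).blocks + w.length) + 22) ≤
        w.length * (21 * (c.blocks + (w.length + 1)) + 22) :=
      Nat.mul_le_mul_left _ (by omega)
    rw [List.length_cons, add_mul, one_mul]
    omega

/-- The state in which the program starts and ends. -/
def init : State s := ⟨none, false, residue s 0, none⟩

/-- The program that computes the items of a formula. -/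
def itemsProg : IProg s :=
  .seq (.emitWord (ThreeCNF.paletteItem s).word) <|
  .seq popInp <|
  .seq mainLoop <|
  .seq (.switch fun v => match v.cl with
    | none => .load id
    | some L => .emitWord (finishWord L)) <|
  .seq popN <|
  .seq drainLoop <|
  .load fun _ => init

theorem runs_itemsProg (φ : ThreeCNF) :
    itemsProg.Runs ⟨init, Prog.single (Γ := Alphabet) Stack.inp φ.encode, []⟩
      (50 * (φ.encode.length + 1) ^ 2) ⟨init, fun _ => [], itemsWord (φ.items s)⟩ := by
  have h₀ : Prog.single (Γ := Alphabet) Stack.inp φ.encode = tapes φ.encode 0 0 := by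
    funext k
    cases k <;> rfl
  have h₁ : (fun _ => [] : ∀ j, List (Alphabet j)) = tapes [] 0 0 := by
    funext k
    cases k <;> rfl
  rw [h₀, h₁, ← close_foldl_step]
  set w := φ.encode
  set c : Conf s := ⟨residue s 0, none, 0, (ThreeCNF.paletteItem s).word⟩
  set d := w.foldl Conf.step c with hd
  have hk : d.blocks ≤ w.length := by simpa [c] using blocks_foldl_step_le w c
  -- No further clause symbol closes the last clause, so its tag and padding are written after the
  -- loop.
  have h₂ : (Prog.switch fun v => match v.cl with
      | none => .load id
      | some L => .emitWord (finishWord L) : IProg s).Runs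
      ⟨⟨none, false, d.ctr, d.cl⟩, tapes [] d.blocks 0, d.out⟩ 6
      ⟨⟨none, false, d.ctr, d.cl⟩, tapes [] d.blocks 0, d.close⟩ := by
    refine Prog.Runs.switch (t := 5) ?_
    unfold Conf.close
    rcases d.cl with _ | L
    · exact (Prog.Runs.load _ _).weaken (by omega)
    · have := length_finishWord_le L
      exact (Prog.runs_emitWord _ _ _ _).weaken (by omega)
  refine ((Prog.runs_emitWord _ _ _ _).seq <| (runs_popInp _ _ _ _ _).seq <|
    ((runs_mainLoop w c).congr (by rw [← hd])).seq <| h₂.seq <| (runs_popN _ _ _ _ _).seq <|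
    (runs_drainLoop _ _ rfl _ _ _).seq <| Prog.Runs.load _ _).congr_weaken rfl ?_
  have hp : (ThreeCNF.paletteItem s).word.length = 4 := rfl
  rw [hp]
  have hc : c.blocks = 0 := rfl
  rw [hc]
  nlinarith

end ItemsProg

/-! ### Graphs on lists of labels -/

section ListGraph

variable {V : Type} (adj : V → V → Bool) (hsymm : ∀ u v, adj u v = adj v u)
  (hirrefl : ∀ u, adj u u = false) (l : List V)

/-- The graph on the positions of a list with a given adjacency of the labels. -/
def listGraph : SimpleGraph (Fin l.length) where
  Adj i j := adj (l.get i) (l.get j) = true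
  symm := ⟨fun i j h => by rw [hsymm]; exact h⟩
  loopless := ⟨fun i h => by simp [hirrefl] at h⟩

/-- Labels may repeat in the list, for instance for repeated clauses. Adjacency depends on labels
only, so a coloring of positions yields one of labels by choosing a position for each label. -/
theorem listGraph_colorable_iff {α : Type} [Fintype α] [Nonempty α] :
    (listGraph adj hsymm hirrefl l).Colorable (Fintype.card α) ↔
      ∃ g : V → α, ∀ u ∈ l, ∀ v ∈ l, adj u v = true → g u ≠ g v := by
  constructor
  · intro h
    obtain ⟨κ⟩ : Nonempty ((listGraph adj hsymm hirrefl l).Coloring α) :=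
      ⟨h.toColoring (by simp)⟩
    classical
    have hget : ∀ u ∈ l, ∃ i, l.get i = u := fun u hu => List.get_of_mem hu
    refine ⟨fun u => if h : ∃ i, l.get i = u then κ h.choose else Classical.arbitrary α, ?_⟩
    intro u hu v hv huv
    beta_reduce
    rw [dif_pos (hget u hu), dif_pos (hget v hv)]
    refine κ.valid ?_
    change adj _ _ = true
    rw [(hget u hu).choose_spec, (hget v hv).choose_spec, huv]
  · rintro ⟨g, hg⟩
    refine (SimpleGraph.Coloring.mk (fun i => g (l.get i)) ?_ :
      (listGraph adj hsymm hirrefl l).Coloring α).colorable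
    intro i j hij
    exact hg _ (List.get_mem l i) _ (List.get_mem l j) hij

/-- The graph on the positions of a list, with a vertex cover given by the labels. -/
def listCoveredGraph (cov : V → Bool) (hcov : ∀ u v, adj u v = true → cov u = true ∨ cov v = true) :
    CoveredGraph where
  numVertices := l.length
  graph := listGraph adj hsymm hirrefl l
  cover := Finset.univ.filter fun i => cov (l.get i) = true
  isVertexCover := fun i j hij => by simpa using hcov _ _ hij

theorem encode_listCoveredGraph (cov : V → Bool)
    (hcov : ∀ u v, adj u v = true → cov u = true ∨ cov v = true) :
    (listCoveredGraph adj hsymm hirrefl l cov hcov).encode = matrixWord adj cov l := by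
  have h : ∀ f : V → List GraphSymbol,
      (List.finRange l.length).flatMap (fun i => f (l.get i)) = l.flatMap f := by
    intro f
    conv_rhs => rw [← List.map_get_finRange l, List.flatMap_map]
  have h' : ∀ f : V → GraphSymbol,
      (List.finRange l.length).map (fun i => f (l.get i)) = l.map f := by
    intro f
    conv_rhs => rw [← List.map_get_finRange l, List.map_map]
    rfl
  -- The decidability instance is arbitrary, since the encoding uses the classical one.
  have hc : ∀ (i : Fin l.length)
      (inst : Decidable (i ∈ (listCoveredGraph adj hsymm hirrefl l cov hcov).cover)),
      @decide _ inst = cov (l.get i) := by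
    intro i inst
    rw [Bool.eq_iff_iff, decide_eq_true_eq]
    exact (Finset.mem_filter.trans (by simp))
  have ha : ∀ (i j : Fin l.length)
      (inst : Decidable ((listCoveredGraph adj hsymm hirrefl l cov hcov).graph.Adj i j)),
      @decide _ inst = adj (l.get i) (l.get j) := by
    intro i j inst
    rw [Bool.eq_iff_iff, decide_eq_true_eq]
    rfl
  unfold matrixWord CoveredGraph.encode
  rw [← h]
  simp only [← h']
  refine congrArg (fun f => (List.finRange l.length).flatMap f) (funext fun i => ?_)
  exact congrArg₂ (fun a f => GraphSymbol.row a :: (List.finRange l.length).map f) (hc i _)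
    (funext fun j => congrArg GraphSymbol.entry (ha i j _))

theorem card_cover_listCoveredGraph (cov : V → Bool)
    (hcov : ∀ u v, adj u v = true → cov u = true ∨ cov v = true) :
    (listCoveredGraph adj hsymm hirrefl l cov hcov).cover.card = l.countP cov := by
  conv_rhs => rw [← List.map_get_finRange l, List.countP_map, List.countP_eq_length_filter]
  change (Finset.univ.filter fun i => cov (l.get i) = true).card = _
  rw [Fin.univ_def]
  simp [Finset.card, Finset.filter, Function.comp_def]

end ListGraph

/-! ### The graph of a formula -/

/-- The colors: three copies of the assignments to a block of `s` variables. -/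
abbrev BlockColor (s : ℕ) : Type := Fin 3 × (Fin s → Bool)

/-- The components of an item: the colors of the palette, the three copies of the variable of a
block, and the patterns, each of which forbids one combination of assignments. -/
inductive Component (s : ℕ) where
  | color : BlockColor s → Component s
  | var : Fin 3 → Component s
  | pattern : (Fin 3 → Fin s → Bool) → Component s

instance (s : ℕ) : Finite (Component s) := by
  refine Finite.of_injective (β := BlockColor s ⊕ Fin 3 ⊕ (Fin 3 → Fin s → Bool))
    (fun c => match c with
    | .color x => .inl x
    | .var j => .inr (.inl j)
    | .pattern a => .inr (.inr a)) ?_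
  intro c d h
  cases c <;> cases d <;> simp_all

noncomputable instance (s : ℕ) : Fintype (Component s) := Fintype.ofFinite _

namespace VertexTag

variable {s : ℕ}

/-- Whether a pattern is forbidden by an item: in a block, the three copies have to agree, and in a
clause, some literal has to be true. -/
def Forbids : VertexTag s → (Fin 3 → Fin s → Bool) → Prop
  | palette, _ => False
  | block, a => ¬ ∀ j, a j = a 0
  | clause L, a => ∀ (j : Fin 3) (x : Fin s × Bool), L.1.reverse[j.val]? = some x → a j x.1 ≠ x.2

/-- The slots that an item uses. -/
def Uses : VertexTag s → Fin 3 → Prop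
  | palette, _ => False
  | block, _ => True
  | clause L, j => j.val < L.1.length

/-- The edges between the components of items, each in one direction only. -/
def Edge (share : Fin 3 → Bool) :
    VertexTag s × Component s → VertexTag s × Component s → Prop
  | (.palette, .color x), (.palette, .color y) => x ≠ y
  | (.palette, .color x), (.block, .var j) => x.1 ≠ j
  | (.palette, .color x), (t, .pattern a) => t.Forbids a ∧ ¬ (t.Uses x.1 ∧ a x.1 = x.2)
  | (.block, .var j), (t, .pattern a) => t.Forbids a ∧ t.Uses j ∧ share j = true
  | _, _ => False

open Classical in
/-- The adjacency of components of items. -/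
noncomputable def adj (p q : VertexTag s × Component s) (share : Fin 3 → Bool) : Bool :=
  decide (Edge share p q ∨ Edge share q p)

/-- The components that belong to the vertex cover. -/
def covers : VertexTag s × Component s → Bool
  | (.palette, .color _) => true
  | (.block, .var _) => true
  | _ => false

/-- Edges are directed out of the palette and the block vertices; this is why those form a vertex
cover. -/
theorem Edge.covers {share : Fin 3 → Bool} {p q : VertexTag s × Component s}
    (h : Edge share p q) : covers p = true := by
  unfold Edge at h
  split at h <;> first | rfl | exact h.elim

theorem edge_color_pattern {share : Fin 3 → Bool} {x : BlockColor s} {t : VertexTag s}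
    {a : Fin 3 → Fin s → Bool} : Edge share (.palette, .color x) (t, .pattern a) ↔
      t.Forbids a ∧ ¬ (t.Uses x.1 ∧ a x.1 = x.2) := by
  cases t <;> rfl

theorem edge_var_pattern {share : Fin 3 → Bool} {j : Fin 3} {t : VertexTag s}
    {a : Fin 3 → Fin s → Bool} : Edge share (.block, .var j) (t, .pattern a) ↔
      t.Forbids a ∧ t.Uses j ∧ share j = true := by
  cases t <;> rfl

theorem Edge.cases {share : Fin 3 → Bool} {t t' : VertexTag s} {c c' : Component s}
    (h : Edge share (t, c) (t', c')) :
    (∃ x y, c = .color x ∧ c' = .color y ∧ x ≠ y) ∨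
      (∃ x j, c = .color x ∧ c' = .var j ∧ x.1 ≠ j) ∨
      (∃ x a, c = .color x ∧ c' = .pattern a ∧ t'.Forbids a ∧ ¬ (t'.Uses x.1 ∧ a x.1 = x.2)) ∨
      ∃ j a, c = .var j ∧ c' = .pattern a ∧ t'.Forbids a ∧ share j = true := by
  rcases t with _ | _ | _ <;> rcases c with x | j | a <;> rcases c' with x' | j' | a' <;>
    rcases t' with _ | _ | _ <;> simp_all [Edge]

theorem Edge.irrefl {share : Fin 3 → Bool} (p : VertexTag s × Component s) :
    ¬ Edge share p p := by
  rcases p with ⟨_ | _ | _, _ | _ | _⟩ <;> simp [Edge]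

theorem itemAdj_symm (p q : Item (VertexTag s) × Component s) :
    itemAdj adj p q = itemAdj adj q p := by
  have h : (fun j => decide (p.1.slot j = q.1.slot j)) =
      fun j => decide (q.1.slot j = p.1.slot j) := by
    funext j
    exact decide_eq_decide.2 eq_comm
  rw [itemAdj, h]
  exact decide_eq_decide.2 or_comm

theorem itemAdj_irrefl (p : Item (VertexTag s) × Component s) : itemAdj adj p p = false := by
  simp [itemAdj, adj, Edge.irrefl]

theorem covers_of_itemAdj (p q : Item (VertexTag s) × Component s)
    (h : itemAdj adj p q = true) :
    covers (p.1.tag, p.2) = true ∨ covers (q.1.tag, q.2) = true := by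
  simp only [itemAdj, adj, decide_eq_true_eq] at h
  exact h.imp Edge.covers Edge.covers

theorem itemAdj_of_edge {p q : Item (VertexTag s) × Component s}
    (h : Edge (fun j => decide (p.1.slot j = q.1.slot j)) (p.1.tag, p.2) (q.1.tag, q.2)) :
    itemAdj adj p q = true := by
  simp only [itemAdj, adj, decide_eq_true_eq]
  exact .inl h

theorem forall_itemAdj {α : Type} {P : Item (VertexTag s) × Component s → Prop}
    {g : Item (VertexTag s) × Component s → α}
    (h : ∀ p, P p → ∀ q, P q → Edge (fun j => decide (p.1.slot j = q.1.slot j))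
      (p.1.tag, p.2) (q.1.tag, q.2) → g p ≠ g q) :
    ∀ p, P p → ∀ q, P q → itemAdj adj p q = true → g p ≠ g q := by
  intro p hp q hq hpq
  simp only [itemAdj, adj, decide_eq_true_eq] at hpq
  rcases hpq with hpq | hpq
  · exact h p hp q hq hpq
  · refine (h q hq p hp ?_).symm
    convert hpq using 3
    exact eq_comm

end VertexTag

/-! ### Satisfying assignments versus colorings. -/

namespace ThreeCNF

variable (s : ℕ) [NeZero s] (φ : ThreeCNF)

/-- The vertices of the graph of a formula. -/
noncomputable def vertices : List (Item (VertexTag s) × Component s) :=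
  (itemVertices (φ.items s) Finset.univ.toList).reverse

/-- The graph of a formula with its vertex cover. -/
noncomputable def toCoveredGraph : CoveredGraph :=
  listCoveredGraph (itemAdj VertexTag.adj) VertexTag.itemAdj_symm VertexTag.itemAdj_irrefl
    (φ.vertices s) (fun p => VertexTag.covers (p.1.tag, p.2)) VertexTag.covers_of_itemAdj

variable {s φ}

theorem mem_vertices {p : Item (VertexTag s) × Component s} :
    p ∈ φ.vertices s ↔ p.1 ∈ φ.items s := by
  rcases p with ⟨u, c⟩
  simp [vertices, itemVertices]

theorem mem_items {u : Item (VertexTag s)} :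
    u ∈ φ.items s ↔ (∃ C : {C : List (Fin φ.numVars × Bool) // C.length ≤ 3},
      C.1 ∈ φ.clauses ∧ clauseItem s C = u) ∨
      (∃ b < numBlocks s φ.numVars, blockItem s b = u) ∨ u = paletteItem s := by
  simp only [items, List.mem_append, List.mem_map, List.mem_reverse, List.mem_attachWith,
    List.mem_range, List.mem_singleton]

theorem div_lt_numBlocks {n i : ℕ} (h : i < n) : i / s < numBlocks s n := by
  have hs := NeZero.pos s
  unfold numBlocks
  rw [← Nat.succ_le_iff, Nat.succ_eq_add_one, ← Nat.add_div_right _ hs]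
  exact Nat.div_le_div_right (by omega)

/-- The assignment to a block. -/
def blockAssignment (s : ℕ) {n : ℕ} (a : Fin n → Bool) (b : ℕ) (r : Fin s) : Bool :=
  if h : s * b + r.val < n then a ⟨s * b + r.val, h⟩ else false

/-- Positions beyond the last variable have the default value `false`; no literal refers to them. -/
theorem blockAssignment_div {n : ℕ} (a : Fin n → Bool) (i : Fin n) :
    blockAssignment s a (i.val / s) (residue s i.val) = a i := by
  simp [blockAssignment, Nat.div_add_mod]

theorem getElem?_reverse_shortClause {n : ℕ} (C : List (Fin n × Bool)) (hC : C.length ≤ 3)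
    (j : ℕ) : (shortClause s C hC).1.reverse[j]? =
      (C[j]?).map fun l => (residue s l.1.val, l.2) := by
  simp [shortClause]

/-- A satisfying assignment never shows a forbidden pattern. For a block, agreement in all slots
would make the pattern constant. For a clause, the slot of a true literal disagrees, since the
pattern falsifies that literal. -/
theorem exists_ne_of_forbids {a : Fin φ.numVars → Bool}
    (ha : ∀ C ∈ φ.clauses, ∃ l ∈ C, a l.1 = l.2) {u : Item (VertexTag s)} (hu : u ∈ φ.items s)
    {p : Fin 3 → Fin s → Bool} (hp : u.tag.Forbids p) :
    ∃ j, u.tag.Uses j ∧ p j ≠ blockAssignment s a (u.slot j) := by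
  rcases mem_items.1 hu with ⟨C, hC, rfl⟩ | ⟨b, _, rfl⟩ | rfl
  · obtain ⟨l, hl, hal⟩ := ha _ hC
    obtain ⟨i, hi, rfl⟩ := List.getElem_of_mem hl
    have h3 := C.2
    refine ⟨⟨i, by omega⟩, ?_, ?_⟩
    · simpa [clauseItem, VertexTag.Uses, shortClause] using hi
    · intro h
      refine hp ⟨i, by omega⟩ (residue s (C.1[i]).1.val, (C.1[i]).2) ?_ ?_
      · rw [getElem?_reverse_shortClause]
        simp [hi]
      · rw [h, ← hal]
        simp [clauseItem, hi, blockAssignment_div]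
  · by_contra! h
    refine hp fun j => ?_
    rw [h j trivial, h 0 trivial]
    rfl
  · exact hp.elim

theorem exists_coloring (h : φ.Satisfiable) :
    ∃ g : Item (VertexTag s) × Component s → BlockColor s, ∀ p ∈ φ.vertices s,
      ∀ q ∈ φ.vertices s, itemAdj VertexTag.adj p q = true → g p ≠ g q := by
  classical
  obtain ⟨a, ha⟩ := h
  set A := blockAssignment s a with hA
  -- A forbidden pattern takes the color `(j, b j)` of a used slot `j` at which it differs from the
  -- assignment: this palette color is not a neighbor, and the block vertex in slot `j` has another
  -- color. The default goes to patterns that are not forbidden, which have no neighbors.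
  refine ⟨fun p => match p.2 with
    | .color x => x
    | .var j => (j, A (p.1.slot j))
    | .pattern b => if h : ∃ j, p.1.tag.Uses j ∧ b j ≠ A (p.1.slot j) then (h.choose, b h.choose)
      else (0, fun _ => false), ?_⟩
  refine VertexTag.forall_itemAdj (P := (· ∈ φ.vertices s)) ?_
  rintro ⟨u, c⟩ hp ⟨w, d⟩ hq h
  have key : ∀ b, w.tag.Forbids b → ∃ j, w.tag.Uses j ∧ b j ≠ A (w.slot j) :=
    fun b hb => exists_ne_of_forbids ha (mem_vertices.1 hq) hb
  rcases h.cases with ⟨x, y, rfl, rfl, hxy⟩ | ⟨x, j, rfl, rfl, hxj⟩ | ⟨x, b, rfl, rfl, hb, hx⟩ |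
    ⟨j, b, rfl, rfl, hb, hj⟩
  · exact hxy
  · exact fun h => hxj (congrArg Prod.fst h)
  · have hk := key b hb
    simp only [dif_pos hk]
    intro h
    refine hx ?_
    rw [h]
    exact ⟨hk.choose_spec.1, rfl⟩
  · have hk := key b hb
    simp only [dif_pos hk]
    intro h
    obtain ⟨h₁, h₂⟩ := Prod.mk.inj h
    refine hk.choose_spec.2 ?_
    rw [← h₂, ← h₁, of_decide_eq_true hj]

/-- The palette is a clique of size `q`, so `π` is a permutation of the colors and every color can
be renamed through it. The `j`-th vertex of block `b` must then have a color `π (j, A j b)`. If the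
assignments shown in the slots of an item formed a forbidden pattern, each color left over by the
palette would be taken by a block vertex, and the pattern vertex could not be colored. -/
theorem satisfiable_of_coloring {g : Item (VertexTag s) × Component s → BlockColor s}
    (hg : ∀ p ∈ φ.vertices s, ∀ q ∈ φ.vertices s, itemAdj VertexTag.adj p q = true → g p ≠ g q) :
    φ.Satisfiable := by
  have hedge : ∀ u ∈ φ.items s, ∀ c, ∀ w ∈ φ.items s, ∀ d,
      VertexTag.Edge (fun j => decide (u.slot j = w.slot j)) (u.tag, c) (w.tag, d) →
      g (u, c) ≠ g (w, d) := fun u hu c w hw d h =>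
    hg _ (mem_vertices.2 hu) _ (mem_vertices.2 hw) (VertexTag.itemAdj_of_edge h)
  have hpal : paletteItem s ∈ φ.items s := mem_items.2 (.inr (.inr rfl))
  have hblock : ∀ b < numBlocks s φ.numVars, blockItem s b ∈ φ.items s :=
    fun b hb => mem_items.2 (.inr (.inl ⟨b, hb, rfl⟩))
  set π : BlockColor s → BlockColor s := fun x => g (paletteItem s, .color x) with hπ
  have hinj : Function.Injective π := by
    intro x y hxy
    by_contra hne
    exact hedge _ hpal (.color x) _ hpal (.color y) hne hxy
  have hsurj : Function.Surjective π := Finite.surjective_of_injective hinj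
  -- The bound on `b` stands inside the existential so that `A` is total; its values beyond the last
  -- block are irrelevant.
  have hvar : ∀ (j : Fin 3) (b : ℕ), ∃ A : Fin s → Bool, b < numBlocks s φ.numVars →
      π (j, A) = g (blockItem s b, .var j) := by
    intro j b
    obtain ⟨⟨i, A⟩, hx⟩ := hsurj (g (blockItem s b, .var j))
    refine ⟨A, fun hb => ?_⟩
    by_cases hij : i = j
    · rw [← hij] at hx ⊢
      exact hx
    · exact absurd hx (hedge _ hpal (.color (i, A)) _ (hblock b hb) (.var j) hij)
  choose A hA using hvar
  -- Only used slots have to name an existing block: an unused slot holds the default 0, and there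
  -- may be no block at all.
  have key : ∀ u ∈ φ.items s, (∀ j, u.tag.Uses j → u.slot j < numBlocks s φ.numVars) →
      ¬ u.tag.Forbids fun j => A j (u.slot j) := by
    intro u hu hslot hF
    obtain ⟨x, hx⟩ := hsurj (g (u, .pattern fun j => A j (u.slot j)))
    have h₁ : u.tag.Uses x.1 ∧ A x.1 (u.slot x.1) = x.2 := by
      by_contra h
      exact hedge _ hpal (.color x) u hu _ (VertexTag.edge_color_pattern.2 ⟨hF, h⟩) hx
    refine hedge _ (hblock _ (hslot _ h₁.1)) (.var x.1) u hu
      (.pattern fun j => A j (u.slot j)) (VertexTag.edge_var_pattern.2 ⟨hF, h₁.1, ?_⟩) ?_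
    · simp [blockItem]
    · rw [← hA _ _ (hslot _ h₁.1), h₁.2]
      exact hx
  -- All slots of a block item hold the block itself, so its gadgets force the three copies to
  -- agree, and copy 0 can be read off as the assignment.
  have hconst : ∀ b < numBlocks s φ.numVars, ∀ j, A j b = A 0 b := by
    intro b hb
    by_contra h
    exact key _ (hblock b hb) (fun _ _ => hb) h
  refine ⟨fun i => A 0 (i.val / s) (residue s i.val), fun C hC => ?_⟩
  have hlen := φ.length_le C hC
  have hF := key (clauseItem s ⟨C, hlen⟩) (mem_items.2 (.inl ⟨⟨C, hlen⟩, hC, rfl⟩)) (by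
    intro j hj
    have hj' : j.val < C.length := by
      simpa [clauseItem, VertexTag.Uses, shortClause] using hj
    simpa [clauseItem, hj'] using div_lt_numBlocks (C[j.val]).1.2)
  simp only [clauseItem, VertexTag.Forbids, not_forall] at hF
  obtain ⟨j, x, hx, hne⟩ := hF
  rw [getElem?_reverse_shortClause] at hx
  obtain ⟨l, hl, rfl⟩ := Option.map_eq_some_iff.1 hx
  refine ⟨l, List.mem_of_getElem? hl, ?_⟩
  rw [not_not, hl] at hne
  simp only [Option.map_some, Option.getD_some] at hne
  rwa [hconst _ (div_lt_numBlocks l.1.2)] at hne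

theorem colorable_toCoveredGraph_iff :
    (φ.toCoveredGraph s).graph.Colorable (3 * 2 ^ s) ↔ φ.Satisfiable := by
  have hcard : Fintype.card (BlockColor s) = 3 * 2 ^ s := by simp
  rw [← hcard]
  refine (listGraph_colorable_iff _ VertexTag.itemAdj_symm VertexTag.itemAdj_irrefl _).trans
    ⟨?_, exists_coloring⟩
  rintro ⟨g, hg⟩
  exact satisfiable_of_coloring hg

end ThreeCNF

/-! ### Sizes of the vertex cover and of the encodings. -/

/-- The number of components of an item that belong to the vertex cover. -/
noncomputable def VertexTag.numCovers {s : ℕ} (t : VertexTag s) : ℕ :=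
  (Finset.univ : Finset (Component s)).toList.countP fun c => VertexTag.covers (t, c)

namespace VertexTag

variable {s : ℕ}

theorem numCovers_le_card {A : Type} [Fintype A] {t : VertexTag s} (g : A → Component s)
    (h : ∀ c, covers (t, c) = true → c ∈ Set.range g) : numCovers t ≤ Fintype.card A := by
  classical
  have h₁ : numCovers t = (Finset.univ.filter fun c => covers (t, c) = true).card := by
    rw [numCovers, List.countP_eq_length_filter, ← List.toFinset_card_of_nodup
      ((Finset.nodup_toList _).filter _), List.toFinset_filter, Finset.toList_toFinset]
  rw [h₁, ← Finset.card_univ]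
  refine (Finset.card_le_card fun c hc => ?_).trans (Finset.card_image_le (f := g))
  simpa using h c (by simpa using hc)

theorem numCovers_palette_le : numCovers (.palette : VertexTag s) ≤ 3 * 2 ^ s := by
  refine (numCovers_le_card Component.color fun c hc => ?_).trans (by simp [BlockColor])
  cases c <;> simp_all [covers]

theorem numCovers_block_le : numCovers (.block : VertexTag s) ≤ 3 := by
  refine (numCovers_le_card Component.var fun c hc => ?_).trans (by simp)
  cases c <;> simp_all [covers]

theorem numCovers_clause (L : ShortClause s) : numCovers (.clause L) = 0 := by
  unfold numCovers
  rw [List.countP_eq_zero]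
  intro c _
  cases c <;> simp [covers]

end VertexTag

namespace ThreeCNF

theorem numBlocks_mul_le (s n : ℕ) : numBlocks s n * s ≤ n + s := by
  have := Nat.div_mul_le_self (n + s - 1) s
  unfold numBlocks
  omega

variable (s : ℕ) [NeZero s] (φ : ThreeCNF)

theorem numBlocks_le (n : ℕ) : numBlocks s n ≤ n := by
  induction n with
  | zero => simp [numBlocks_zero]
  | succ n ih =>
    rw [numBlocks_succ]
    split <;> omega

/-- Count cover vertices item by item: the palette has at most `3 * 2 ^ s`, a block at most 3, a
clause none. The bound is therefore independent of the number of clauses. -/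
theorem card_cover_le :
    (φ.toCoveredGraph s).cover.card ≤ 3 * 2 ^ s + 3 * numBlocks s φ.numVars := by
  have h : (φ.toCoveredGraph s).cover.card = ((φ.items s).map fun u => u.tag.numCovers).sum := by
    unfold toCoveredGraph
    rw [card_cover_listCoveredGraph, vertices, List.countP_reverse, itemVertices,
      List.countP_flatMap]
    congr 2
    funext u
    simp [VertexTag.numCovers, List.countP_map, Function.comp_def]
  have h₁ := VertexTag.numCovers_palette_le (s := s)
  have h₂ := Nat.mul_le_mul_left (numBlocks s φ.numVars) (VertexTag.numCovers_block_le (s := s))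
  rw [h, items]
  simp only [List.map_append, List.map_map, List.sum_append, Function.comp_def, clauseItem,
    blockItem, paletteItem, VertexTag.numCovers_clause, List.map_const', List.sum_replicate,
    List.length_reverse, List.length_range, List.map_cons, List.map_nil, List.sum_cons,
    List.sum_nil, smul_eq_mul]
  omega

theorem length_clauses_add_numVars_le : φ.clauses.length + φ.numVars ≤ φ.encode.length := by
  have h : φ.clauses.length ≤ (φ.clauses.flatMap encodeClause).length := by
    rw [List.length_flatMap]
    generalize φ.clauses = F
    induction F with
    | nil => simp
    | cons C F ih =>
      simp only [List.map_cons, List.sum_cons, List.length_cons, encodeClause] at *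
      omega
  simp only [encode, List.length_append, List.length_replicate]
  omega

theorem length_items_le : (φ.items s).length ≤ φ.encode.length + 1 := by
  have h₁ := φ.length_clauses_add_numVars_le
  have h₂ := numBlocks_le s φ.numVars
  simp [items]
  omega

theorem slot_le {u : Item (VertexTag s)} (hu : u ∈ φ.items s) (j : Fin 3) :
    u.slot j ≤ φ.numVars := by
  rcases mem_items.1 hu with ⟨C, _, rfl⟩ | ⟨b, hb, rfl⟩ | rfl
  · simp only [clauseItem]
    rcases C.1[j.val]? with _ | l
    · simp
    · simpa using (Nat.div_le_self _ _).trans l.1.2.le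
  · exact hb.le.trans (numBlocks_le s _)
  · simp [paletteItem]

theorem length_itemsWord_le :
    (itemsWord (φ.items s)).length ≤ 4 * (φ.encode.length + 1) ^ 2 := by
  have h₁ := φ.length_clauses_add_numVars_le
  have h₂ := φ.length_items_le s
  have h₃ : ((φ.items s).map fun u => u.word.length).sum ≤
      ((φ.items s).map fun u => u.word.length).length • (3 * φ.encode.length + 4) := by
    refine List.sum_le_card_nsmul _ _ fun k hk => ?_
    obtain ⟨u, hu, rfl⟩ := List.mem_map.1 hk
    have h0 := φ.slot_le s hu 0
    have h1 := φ.slot_le s hu 1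
    have h2 := φ.slot_le s hu 2
    rw [Item.length_word]
    omega
  unfold itemsWord
  rw [List.length_flatMap]
  refine h₃.trans ?_
  rw [List.length_map, smul_eq_mul]
  calc _ ≤ (φ.encode.length + 1) * (3 * φ.encode.length + 4) := Nat.mul_le_mul_right _ h₂
    _ ≤ _ := by nlinarith

theorem length_encode_toCoveredGraph_le :
    (φ.toCoveredGraph s).encode.length + 1 ≤
      ((Fintype.card (Component s) + 1) * (φ.encode.length + 1)) ^ 2 := by
  have h : (φ.toCoveredGraph s).numVertices ≤
      Fintype.card (Component s) * (φ.encode.length + 1) := by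
    change (φ.vertices s).length ≤ _
    have : (φ.vertices s).length = Fintype.card (Component s) * (φ.items s).length := by
      simp [vertices, itemVertices, List.length_flatMap, mul_comm]
    rw [this]
    exact Nat.mul_le_mul_left _ (φ.length_items_le s)
  rw [CoveredGraph.length_encode]
  set N := (φ.toCoveredGraph s).numVertices
  have h' : N + 1 ≤ (Fintype.card (Component s) + 1) * (φ.encode.length + 1) := by
    rw [add_mul]
    omega
  calc N * (N + 1) + 1 ≤ (N + 1) ^ 2 := by nlinarith
    _ ≤ _ := Nat.pow_le_pow_left h' 2

end ThreeCNF

/-! ### The reduction machine and its running time. -/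

noncomputable instance {T : Type} [Finite T] : Fintype (ItemSymbol T) := Fintype.ofFinite _

/-- The machine that turns a formula into a graph and runs a given machine on it. -/
noncomputable def reductionMachine (s : ℕ) [NeZero s] (M : Turing.TM2ComputableAux GraphSymbol Bool) :
    Turing.TM2ComputableAux CNFSymbol Bool :=
  ItemsProg.itemsProg.prepend
    ((MatrixProg.matrixProg (Finset.univ : Finset (Component s)).toList VertexTag.adj
      VertexTag.covers).prepend M .a (Equiv.refl _) (MatrixProg.base default))
    .inp (Equiv.refl _) (ItemsProg.init (s := s))

theorem outputsInTime_reductionMachine (s : ℕ) [NeZero s]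
    (M : Turing.TM2ComputableAux GraphSymbol Bool) (φ : ThreeCNF) {z : List Bool} {t : ℕ}
    (h : Nonempty (Turing.TM2OutputsInTime M.tm
      ((φ.toCoveredGraph s).encode.map M.inputAlphabet.symm)
      (some (z.map M.outputAlphabet.symm)) t)) :
    Nonempty (Turing.TM2OutputsInTime (reductionMachine s M).tm
      (φ.encode.map (reductionMachine s M).inputAlphabet.symm)
      (some (z.map (reductionMachine s M).outputAlphabet.symm))
      (50 * (φ.encode.length + 1) ^ 2 +
        (200 * (Fintype.card (Component s) + 1) ^ 2 * ((itemsWord (φ.items s)).length + 1) ^ 3 +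
          t))) := by
  have h₁ := ItemsProg.runs_itemsProg (s := s) φ
  have h₂ := MatrixProg.runs_matrixProg (Finset.univ : Finset (Component s)).toList VertexTag.adj
    VertexTag.covers (φ.items s)
  rw [Finset.length_toList, Finset.card_univ] at h₂
  unfold ThreeCNF.toCoveredGraph at h
  rw [encode_listCoveredGraph] at h
  refine Prog.Runs.outputsInTime_prepend _ (Equiv.refl _) (by simpa using h₁) ?_
  exact Prog.Runs.outputsInTime_prepend M (Equiv.refl _) (by simpa [ThreeCNF.vertices] using h₂) h

/-- It suffices that `s` exceeds `3 * log θ / (ε * log 2)`, for then `θ ^ (3 / s) ≤ 2 ^ ε`. There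
are at most `n / s + 1` blocks; the factor `θ ^ 3` pays for rounding up. -/
theorem exists_pow_numBlocks_le {θ ε : ℝ} (hθ : 1 ≤ θ) (hε : 0 < ε) :
    ∃ s : ℕ, 0 < s ∧ ∀ n : ℕ,
      θ ^ (3 * ThreeCNF.numBlocks s n) ≤ θ ^ 3 * (2 : ℝ) ^ (ε * (n : ℝ)) := by
  have h2 : 0 < Real.log 2 := Real.log_pos one_lt_two
  have hθ0 : 0 < θ := by linarith
  have hlog : 0 ≤ Real.log θ := Real.log_nonneg hθ
  obtain ⟨r, hr⟩ := exists_nat_gt (3 * Real.log θ / (ε * Real.log 2))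
  have hr' : 3 * Real.log θ ≤ ε * Real.log 2 * (r + 1 : ℕ) := by
    rw [div_lt_iff₀ (by positivity)] at hr
    push_cast
    nlinarith [mul_pos hε h2]
  refine ⟨r + 1, Nat.succ_pos r, fun n => ?_⟩
  rw [← Real.log_le_log_iff (by positivity) (by positivity), Real.log_mul (by positivity)
    (by positivity), Real.log_pow, Real.log_pow, Real.log_rpow two_pos]
  have hb : (ThreeCNF.numBlocks (r + 1) n : ℝ) * (r + 1 : ℕ) ≤ n + (r + 1 : ℕ) := by
    exact_mod_cast ThreeCNF.numBlocks_mul_le (r + 1) n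
  have hs : (0 : ℝ) < (r + 1 : ℕ) := by positivity
  refine le_of_mul_le_mul_right ?_ hs
  have hn : (0 : ℝ) ≤ n := n.cast_nonneg
  push_cast at *
  nlinarith [mul_le_mul_of_nonneg_left hb hlog, mul_le_mul_of_nonneg_left hr' hn]

theorem solvableInOStar_threeSAT {θ : ℝ} (h : ∀ q : ℕ, 1 ≤ q →
    (ColoringByVertexCover q).SolvableInOStar (fun k => θ ^ k)) {ε : ℝ} (hε : 0 < ε) :
    ThreeSAT.SolvableInOStar (fun n => (2 : ℝ) ^ (ε * (n : ℝ))) := by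
  -- `θ` may be negative or less than 1; powers of `Θ` dominate those of `θ` and are monotone in the
  -- exponent.
  set Θ : ℝ := max |θ| 1 with hΘ
  have hΘ1 : 1 ≤ Θ := le_max_right _ _
  obtain ⟨s, hs, hpow⟩ := exists_pow_numBlocks_le hΘ1 hε
  have : NeZero s := ⟨hs.ne'⟩
  obtain ⟨M, C, c, hM⟩ := h (3 * 2 ^ s) (Nat.succ_le_of_lt (by positivity))
  set f := Fintype.card (Component s) with hf
  set D : ℝ := C * Θ ^ (3 * 2 ^ s + 3) * ((f : ℝ) + 1) ^ (2 * c) with hD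
  have hD0 : 0 ≤ D := by positivity
  -- The three summands pay for the items, the matrix and `M`. Here `25000 = 200 * 5 ^ 3`, as the
  -- item word is at most quadratic in the input; cubing that gives the exponent 6. The graph
  -- encoding is polynomial of degree 2, whence `2 * c`.
  refine ⟨reductionMachine s M, ⌈50 + 25000 * ((f : ℝ) + 1) ^ 2 + D⌉₊, 6 + 2 * c, fun φ => ?_⟩
  obtain ⟨t, ht, answer, hans, hout⟩ := hM (φ.toCoveredGraph s)
  refine ⟨_, ?_, answer, ?_, outputsInTime_reductionMachine s M φ hout⟩
  · change _ ≤ _ * (2 : ℝ) ^ (ε * (φ.numVars : ℝ)) * ((φ.encode.length : ℝ) + 1) ^ (6 + 2 * c)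
    set X : ℝ := (φ.encode.length : ℝ) + 1 with hX
    set E : ℝ := (2 : ℝ) ^ (ε * (φ.numVars : ℝ)) with hE
    have hX1 : 1 ≤ X := by
      rw [hX]
      linarith [(φ.encode.length).cast_nonneg (α := ℝ)]
    -- This lets the polynomial cost of the reduction be absorbed into the exponential bound.
    have hE1 : 1 ≤ E := Real.one_le_rpow one_le_two (by positivity)
    have hL : (((itemsWord (φ.items s)).length : ℝ) + 1) ≤ 5 * X ^ 2 := by
      have : ((itemsWord (φ.items s)).length : ℝ) ≤ 4 * X ^ 2 := by
        rw [hX]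
        exact_mod_cast φ.length_itemsWord_le s
      nlinarith
    have hk : θ ^ (φ.toCoveredGraph s).cover.card ≤ Θ ^ (3 * 2 ^ s + 3) * E := by
      calc θ ^ (φ.toCoveredGraph s).cover.card
          ≤ |θ| ^ (φ.toCoveredGraph s).cover.card := by
            rw [← abs_pow]
            exact le_abs_self _
        _ ≤ Θ ^ (φ.toCoveredGraph s).cover.card := by
            gcongr
            exact le_max_left _ _
        _ ≤ Θ ^ (3 * 2 ^ s + 3 * ThreeCNF.numBlocks s φ.numVars) :=
            pow_le_pow_right₀ hΘ1 (φ.card_cover_le s)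
        _ ≤ Θ ^ (3 * 2 ^ s + 3) * E := by
            rw [pow_add, pow_add, mul_assoc]
            gcongr
            exact hpow _
    have hlen : (((φ.toCoveredGraph s).encode.length : ℝ) + 1) ^ c ≤
        ((f : ℝ) + 1) ^ (2 * c) * X ^ (2 * c) := by
      rw [← mul_pow, pow_mul]
      gcongr
      rw [hX]
      exact_mod_cast φ.length_encode_toCoveredGraph_le s
    have ht' : (t : ℝ) ≤ D * E * X ^ (2 * c) := by
      calc (t : ℝ) ≤ C * θ ^ (φ.toCoveredGraph s).cover.card *
            (((φ.toCoveredGraph s).encode.length : ℝ) + 1) ^ c := ht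
        _ ≤ C * (Θ ^ (3 * 2 ^ s + 3) * E) * (((f : ℝ) + 1) ^ (2 * c) * X ^ (2 * c)) := by
          gcongr
        _ = D * E * X ^ (2 * c) := by
          rw [hD]
          ring
    have h6 : X ^ 6 ≤ X ^ (6 + 2 * c) := pow_le_pow_right₀ hX1 (by omega)
    have h2 : X ^ 2 ≤ X ^ (6 + 2 * c) := pow_le_pow_right₀ hX1 (by omega)
    have hc : X ^ (2 * c) ≤ X ^ (6 + 2 * c) := pow_le_pow_right₀ hX1 (by omega)
    push_cast
    rw [← hX]
    calc 50 * X ^ 2 + (200 * ((f : ℝ) + 1) ^ 2 *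
          (((itemsWord (φ.items s)).length : ℝ) + 1) ^ 3 + t)
        ≤ 50 * X ^ 2 + (200 * ((f : ℝ) + 1) ^ 2 * (5 * X ^ 2) ^ 3 + D * E * X ^ (2 * c)) := by
          gcongr
      _ = 50 * X ^ 2 + 25000 * ((f : ℝ) + 1) ^ 2 * X ^ 6 + D * E * X ^ (2 * c) := by ring
      _ ≤ 50 * X ^ (6 + 2 * c) + 25000 * ((f : ℝ) + 1) ^ 2 * X ^ (6 + 2 * c) +
          D * E * X ^ (6 + 2 * c) := by gcongr
      _ ≤ 50 * E * X ^ (6 + 2 * c) + 25000 * ((f : ℝ) + 1) ^ 2 * E * X ^ (6 + 2 * c) +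
          D * E * X ^ (6 + 2 * c) := by
          have hY : X ^ (6 + 2 * c) ≤ E * X ^ (6 + 2 * c) :=
            le_mul_of_one_le_left (by positivity) hE1
          simp only [mul_assoc]
          gcongr
      _ = (50 + 25000 * ((f : ℝ) + 1) ^ 2 + D) * E * X ^ (6 + 2 * c) := by ring
      _ ≤ _ := by
          gcongr
          exact Nat.le_ceil _
  · exact hans.trans ThreeCNF.colorable_toCoveredGraph_iff

theorem mainTheorem5 (eth : ETH) :
    ¬ ∃ θ : ℝ, ∀ q : ℕ, 1 ≤ q →
      (ColoringByVertexCover q).SolvableInOStar (fun k => θ ^ k) := by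
  rintro ⟨θ, h⟩
  obtain ⟨ε, hε, hnot⟩ := eth
  exact hnot (solvableInOStar_threeSAT h hε)
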